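/- **Setting.** Let $D=\{|z|<1\}$, let $\mathbb K=\mathbb R$ or $\mathbb K=\mathbb C$, and let $\mathbf t=(t_1,t_3,t_5,\dots)$ be sequences in $\mathbb K$ (the times) for which $S_0(z,\mathbf t)=\sum_{n\ge 0}t_{2n+1}z^{2n+1}$ has radius of convergence larger than $1$. Let $T$ be a set of such sequences that is open along every coordinate line. Write $\partial_z,\partial_{\bar z}$ for the Wirtinger derivatives and $dz\wedge d\bar z=-2\mathrm i\,dx\wedge dy$. Let $\Omega\subseteq D\times\mathbb C$ and let $W=W(z,\bar z,\eta)$ be a complex-valued function of $(z,\eta)\in\Omega$ ($\bar\partial$-data localized in $D$, i.e. $W=0$ for $|z|>1$) with the symmetry $$(z,\eta)\in\Omega\ \Rightarrow\ (-z,\eta)\in\Omega,\qquad W(-z,-\bar z,\eta)=W(z,\bar z,\eta).$$ Let $W_{-1}$ be an antiderivative of $W$ in the complex sense, $\partial_\eta W_{-1}(z,\bar z,\eta)=W(z,\bar z,\eta)$ for $(z,\eta)\in\Omega$. A *solution at* $\mathbf t$ is $S=S_0(\cdot,\mathbf t)+\widetilde S$ such that $\widetilde S$ is continuous on $\mathbb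 C$, $C^2$ on $\overline D$ (up to the boundary from inside), holomorphic for $|z|>1$, tends to $0$ at $\infty$, and in $D$ satisfies $(z,S_z)\in\Omega$ and the nonlinear Beltrami equation $$S_{\bar z}=W(z,\bar z,S_z).$$ **Theorem.** Suppose that for each $\mathbf t\in T$ there is exactly one solution $S(\cdot,\mathbf t)=S_0(\cdot,\mathbf t)+\widetilde S(\cdot,\mathbf t)$ at $\mathbf t$. Suppose that near each $\mathbf t\in T$ and for each $n$, $\widetilde S$ is a $C^2$ function (in the real sense) of the pair $(t_{2n+1},z)$, $z\in\overline D$, the other times being fixed, and is differentiable over $\mathbb K$ in $t_{2n+1}$, and that $z\mapsto W_{-1}(z,\bar z,S_z(z,\mathbf t))$ is integrable on $D$ for each $\mathbf t\in T$. Let $$F(\mathbf t)=-\frac1{2\pi\mathrm i}\iint_D\Bigl(\tfrac12\widetilde S_{\bar z}(\mathbf t)\,\widetilde S_z(\mathbf t)-W_{-1}\bigl(z,\bar z,S_z(\mathbf t)\bigr)\Bigr)\,dz\wedge d\bar z$$ be the action evaluated on the solution. Then $F_{\mathrm{dBKP}}=\tfrac12F$ is a $\tau$-function of the dBKP hierarchy.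 That is, for every $\mathbf t\in T$, $\widetilde S(-z,\mathbf t)=-\widetilde S(z,\mathbf t)$ for all $z\in\mathbb C$, the derivatives $\partial F/\partial t_{2n+1}$ over $\mathbb K$ exist at $\mathbf t$, and for all $|z|>1$ $$\widetilde S(z,\mathbf t)=-\mathcal D(z)F_{\mathrm{dBKP}}(\mathbf t)=-\tfrac12\,\mathcal D(z)F(\mathbf t),\qquad \mathcal D(z)=2\sum_{n=0}^\infty\frac{z^{-(2n+1)}}{2n+1}\frac{\partial}{\partial t_{2n+1}},$$ where the series converges. -/

import Mathlib

open Complex Filter Topology MeasureTheory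

noncomputable section

namespace DBKP

/-- The Wirtinger derivative `∂f/∂z = (∂f/∂x - i ∂f/∂y) / 2`. -/
def dz (f : ℂ → ℂ) (z : ℂ) : ℂ :=
  (fderiv ℝ f z 1 - I * fderiv ℝ f z I) / 2

/-- The Wirtinger derivative `∂f/∂z̄ = (∂f/∂x + i ∂f/∂y) / 2`. -/
def dzbar (f : ℂ → ℂ) (z : ℂ) : ℂ :=
  (fderiv ℝ f z 1 + I * fderiv ℝ f z I) / 2

section Times

variable {𝕜 : Type*} [RCLike 𝕜] [NormedAlgebra 𝕜 ℂ]

/-- The sequence of times `t` is indexed so that `t n` is the time usually written `t_{2n+1}`.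
It is admissible when the odd power series `∑ t_{2n+1} z^{2n+1}` has radius of convergence
larger than one. -/
def Admissible (t : ℕ → 𝕜) : Prop :=
  ∃ R : ℝ, 1 < R ∧ Summable fun n : ℕ => ‖t n‖ * R ^ (2 * n + 1)

/-- `S₀(z, t) = ∑ t_{2n+1} z^{2n+1}`. -/
def S₀ (t : ℕ → 𝕜) (z : ℂ) : ℂ :=
  ∑' n : ℕ, t n • z ^ (2 * n + 1)

/-- `v` is the part `S̃` of a solution `S = S₀ + S̃` of the `∂̄`-problem `S_z̄ = W(z, z̄, S_z)` at
the times `t`. The dependence of `W` on `z̄` is implicit, as `W z η` is any function of the complex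
number `z`. The data are localized in the unit disc, that is, `W` is zero for `|z| > 1`,
where the equation says that `S̃` is holomorphic; so only the values `W z η` with `|z| < 1` occur.
The values `(z, S_z)` have to lie in the domain `Ω` of the data. -/
structure IsSolution (Ω : Set (ℂ × ℂ)) (W : ℂ → ℂ → ℂ) (t : ℕ → 𝕜) (v : ℂ → ℂ) : Prop where
  continuous : Continuous v
  regular : ContDiffOn ℝ 2 v (Metric.closedBall 0 1)
  holomorphic : DifferentiableOn ℂ v {z | 1 < ‖z‖}
  vanishing : Tendsto v (cocompact ℂ) (𝓝 0)
  mem_domain : ∀ z, ‖z‖ < 1 → (z, dz (fun w => S₀ t w + v w) z) ∈ Ω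
  beltrami : ∀ z, ‖z‖ < 1 →
    dzbar (fun w => S₀ t w + v w) z = W z (dz (fun w => S₀ t w + v w) z)

/-- The set `T` of times is open along every coordinate line, so that all the derivatives
`∂/∂t_{2n+1}` make sense at its points. -/
def CoordOpen (T : Set (ℕ → 𝕜)) : Prop :=
  ∀ t ∈ T, ∀ n : ℕ, ∀ᶠ s in 𝓝 (0 : 𝕜), t + Pi.single n s ∈ T

/-- `S̃` depends regularly on each single time: it is `C²` in the pair of this time and of the
point of the closed unit disc, and (of importance for complex times only) it is differentiable
over `𝕜` with respect to this time. -/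
def RegularInTimes (T : Set (ℕ → 𝕜)) (u : (ℕ → 𝕜) → ℂ → ℂ) : Prop :=
  ∀ t ∈ T, ∀ n : ℕ, ∃ ε : ℝ, 0 < ε ∧
    ContDiffOn ℝ 2 (fun p : 𝕜 × ℂ => u (t + Pi.single n p.1) p.2)
      (Metric.ball 0 ε ×ˢ Metric.closedBall 0 1) ∧
    ∀ z ∈ Metric.closedBall (0 : ℂ) 1,
      DifferentiableOn 𝕜 (fun s : 𝕜 => u (t + Pi.single n s) z) (Metric.ball 0 ε)

/-- The action
`F(t) = -(1/2πi) ∬_D (½ S̃_z̄ S̃_z - W₋₁(z, z̄, S_z)) dz ∧ dz̄`, where `dz ∧ dz̄ = -2i dx dy`. -/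
def action (Wm1 : ℂ → ℂ → ℂ) (u : (ℕ → 𝕜) → ℂ → ℂ) (t : ℕ → 𝕜) : ℂ :=
  -(1 / (2 * Real.pi * I)) *
    ∫ z in Metric.ball (0 : ℂ) 1,
      (1 / 2 * dzbar (u t) z * dz (u t) z - Wm1 z (dz (fun w => S₀ t w + u t w) z)) * (-2 * I)

/-- `∂G/∂t_{2n+1}` at `t`. -/
def timeDeriv (n : ℕ) (G : (ℕ → 𝕜) → ℂ) (t : ℕ → 𝕜) : ℂ :=
  deriv (fun s : 𝕜 => G (t + Pi.single n s)) 0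

/-- All the derivatives `∂G/∂t_{2n+1}` exist at `t`, and the series
`𝒟(z) G = 2 ∑ z^{-(2n+1)} / (2n+1) ∂G/∂t_{2n+1}` converges at `t` to the value `a`. -/
def HasVertexDeriv (z : ℂ) (G : (ℕ → 𝕜) → ℂ) (t : ℕ → 𝕜) (a : ℂ) : Prop :=
  (∀ n : ℕ, DifferentiableAt 𝕜 (fun s : 𝕜 => G (t + Pi.single n s)) 0) ∧
    HasSum (fun n : ℕ => 2 * ((z ^ (2 * n + 1))⁻¹ / (2 * n + 1 : ℂ) * timeDeriv n G t)) a

/-- `G` is a `τ`-function of the dBKP hierarchy for the family `S = S₀ + u`: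
`S̃` is odd in `z`, and `S̃(z, t) = -𝒟(z) G(t)` for `|z| > 1`. -/
def IsTauFunction (T : Set (ℕ → 𝕜)) (u : (ℕ → 𝕜) → ℂ → ℂ) (G : (ℕ → 𝕜) → ℂ) : Prop :=
  ∀ t ∈ T, (∀ z, u t (-z) = -u t z) ∧
    ∀ z : ℂ, 1 < ‖z‖ → HasVertexDeriv z G t (-u t z)

end Times

end DBKP

end

noncomputable section

namespace DBKP

open Metric Set

/-! ### The divergence theorem on the unit disc -/

/-! The point is that the solution makes the action stationary up to its explicit dependence on the
times. Let `p` be the derivative of `S̃` in `t_{2n+1}`. Since `∂W₋₁/∂η = W` and `W = S_z̄ = S̃_z̄`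
on a solution (`S₀` is holomorphic), the integrand of the action has derivative `½ (p_z̄ S̃_z -
S̃_z̄ p_z) - (2n+1) z^{2n} S̃_z̄`.

The first term is a Jacobian. By Green's formula (`integral_ball_jacobian`) its integral is a
multiple of `∮ p dS̃`, which vanishes (`integral_velocity_mul_deriv`) because `∮ v₁ dv₂ = 0` for
functions holomorphic outside the disc and zero at infinity: on the circle only non-positive modes
occur. By Cauchy–Green (`integral_ball_dzbar`) the second term gives the moment `∮ e^{i(2n+1)θ} S̃
dθ`, which is `2π` times a Laurent coefficient of `S̃` at infinity. Hence `∂F/∂t_{2n+1}` is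
`-(2n+1)` times the coefficient of `z^{-(2n+1)}` (`hasDerivAt_action`).

Uniqueness and the symmetry of the data make `S̃` odd, so these coefficients are the whole Laurent
series, and its convergence for `|z| > 1` is the convergence of `𝒟(z)F`. -/

lemma exp_mul_I_mem_closedBall (θ : ℝ) : exp (θ * I) ∈ closedBall (0 : ℂ) 1 := by
  simp [Complex.norm_exp_ofReal_mul_I]

lemma uniqueDiffOn_closedBall : UniqueDiffOn ℝ (closedBall (0 : ℂ) 1) :=
  uniqueDiffOn_convex (convex_closedBall 0 1) ⟨0, by rw [interior_closedBall _ one_ne_zero]; simp⟩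

/-- Integration over the unit disc in polar coordinates. -/
lemma integral_ball_eq_polar (g : ℂ → ℂ) :
    ∫ z in ball (0 : ℂ) 1, g z =
      ∫ p in Ioo (0 : ℝ) 1 ×ˢ Ioo (-Real.pi) Real.pi, p.1 • g (p.1 * exp (p.2 * I)) := by
  rw [← integral_indicator measurableSet_ball, ← Complex.integral_comp_polarCoord_symm]
  have h1 : Ioo (0 : ℝ) 1 ×ˢ Ioo (-Real.pi) Real.pi =
      polarCoord.target ∩ {p : ℝ × ℝ | p.1 < 1} := by
    ext p
    simp only [polarCoord_target, mem_prod, mem_Ioo, mem_Ioi, mem_inter_iff, mem_ofPred_eq]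
    tauto
  have hm : MeasurableSet {p : ℝ × ℝ | p.1 < 1} := measurableSet_lt measurable_fst measurable_const
  rw [h1, ← setIntegral_indicator hm]
  refine setIntegral_congr_fun polarCoord.open_target.measurableSet fun p hp => ?_
  have hp0 : 0 < p.1 := by simpa using hp.1
  have h2 : (p.1 : ℂ) * (Real.cos p.2 + Real.sin p.2 * I) = p.1 * exp (p.2 * I) := by
    rw [Complex.exp_mul_I]; simp
  by_cases h : p.1 < 1
  · simp only [Complex.polarCoord_symm_apply, h2]
    rw [indicator_of_mem, indicator_of_mem]
    · exact h
    · simp [abs_of_pos hp0, h]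
  · simp only [Complex.polarCoord_symm_apply, h2]
    rw [indicator_of_notMem, indicator_of_notMem, smul_zero]
    · exact h
    · simpa [abs_of_pos hp0] using h

lemma hasFDerivAt_polar (p : ℝ × ℝ) :
    HasFDerivAt (fun p : ℝ × ℝ => (p.1 : ℂ) * exp (p.2 * I))
      ((ContinuousLinearMap.fst ℝ ℝ ℝ).smulRight (exp (p.2 * I)) +
        (ContinuousLinearMap.snd ℝ ℝ ℝ).smulRight (p.1 * (I * exp (p.2 * I)))) p := by
  have h1 : HasFDerivAt (fun p : ℝ × ℝ => (p.1 : ℂ))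
      (ofRealCLM.comp (ContinuousLinearMap.fst ℝ ℝ ℝ)) p :=
    (ofRealCLM.comp (ContinuousLinearMap.fst ℝ ℝ ℝ)).hasFDerivAt
  have h2 : HasFDerivAt (fun p : ℝ × ℝ => (p.2 : ℂ) * I)
      ((ofRealCLM.comp (ContinuousLinearMap.snd ℝ ℝ ℝ)).smulRight I) p :=
    ((ofRealCLM.comp (ContinuousLinearMap.snd ℝ ℝ ℝ)).smulRight I).hasFDerivAt
  have h3 := h1.mul h2.cexp
  refine h3.congr_fderiv ?_
  ext
  · simp
  · simp [mul_comm I]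

/-- The divergence theorem for a constant vector field multiplied by a function. -/
theorem integral_ball_fderiv {f : ℂ → ℂ} (hf : ContDiffOn ℝ 1 f (closedBall 0 1)) (v : ℂ) :
    ∫ z in ball (0 : ℂ) 1, fderiv ℝ f z v =
      ∫ θ in (-Real.pi)..Real.pi,
        (v.re * Real.cos θ + v.im * Real.sin θ) • f (exp (θ * I)) := by
  set D := fderivWithin ℝ f (closedBall 0 1) with hD
  have hDc : ContinuousOn D (closedBall 0 1) :=
    hf.continuousOn_fderivWithin uniqueDiffOn_closedBall le_rfl
  set e : ℝ × ℝ → ℂ := fun p => (p.1 : ℂ) * exp (p.2 * I) with he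
  have hec : Continuous e := by fun_prop
  have hmaps : MapsTo e (Icc ((0 : ℝ), -Real.pi) (1, Real.pi)) (closedBall 0 1) := by
    intro p hp
    have h0 : 0 ≤ p.1 := hp.1.1
    have h1 : p.1 ≤ 1 := hp.2.1
    simp [he, abs_of_nonneg h0, h1]
  have hfe : ContinuousOn (fun p => f (e p)) (Icc ((0 : ℝ), -Real.pi) (1, Real.pi)) :=
    hf.continuousOn.comp hec.continuousOn hmaps
  have hDe : ContinuousOn (fun p => D (e p)) (Icc ((0 : ℝ), -Real.pi) (1, Real.pi)) :=
    hDc.comp hec.continuousOn hmaps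
  have hder : ∀ z ∈ ball (0 : ℂ) 1, HasFDerivAt f (D z) z := fun z hz =>
    ((hf.differentiableOn one_ne_zero) z (ball_subset_closedBall hz)).hasFDerivWithinAt.hasFDerivAt
      (mem_of_superset (isOpen_ball.mem_nhds hz) ball_subset_closedBall)
  set E : ℝ × ℝ → (ℝ × ℝ →L[ℝ] ℂ) := fun p =>
    (ContinuousLinearMap.fst ℝ ℝ ℝ).smulRight (exp (p.2 * I)) +
        (ContinuousLinearMap.snd ℝ ℝ ℝ).smulRight (p.1 * (I * exp (p.2 * I))) with hE
  -- `c` and `s` are the radial and angular components of `v`. Since `c' = s` and `s' = -c`, one has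
  -- `r ∂_v f = ∂_r (r c f) + ∂_θ (s f)`: the undifferentiated terms `±c f` cancel. `F'` and `G'`
  -- below are the derivatives of `r c f` and `s f`.
  set c : ℝ → ℝ := fun θ => v.re * Real.cos θ + v.im * Real.sin θ with hc
  set s : ℝ → ℝ := fun θ => -v.re * Real.sin θ + v.im * Real.cos θ with hs
  have hcd : ∀ θ, HasDerivAt c (s θ) θ := fun θ => by
    have := ((Real.hasDerivAt_cos θ).const_mul v.re).add ((Real.hasDerivAt_sin θ).const_mul v.im)
    exact this.congr_deriv (by simp [hs])
  have hsd : ∀ θ, HasDerivAt s (-c θ) θ := fun θ => by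
    have := ((Real.hasDerivAt_sin θ).const_mul (-v.re)).add ((Real.hasDerivAt_cos θ).const_mul v.im)
    exact this.congr_deriv (by simp [hc]; ring)
  have hcc : Continuous c := by fun_prop
  have hsc : Continuous s := by fun_prop
  set F' : ℝ × ℝ → (ℝ × ℝ →L[ℝ] ℂ) := fun p =>
    (p.1 * c p.2) • (D (e p)).comp (E p) +
      (p.1 • (s p.2 • ContinuousLinearMap.snd ℝ ℝ ℝ) +
        c p.2 • ContinuousLinearMap.fst ℝ ℝ ℝ).smulRight (f (e p)) with hF'
  set G' : ℝ × ℝ → (ℝ × ℝ →L[ℝ] ℂ) := fun p =>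
    s p.2 • (D (e p)).comp (E p) +
      ((-c p.2) • ContinuousLinearMap.snd ℝ ℝ ℝ).smulRight (f (e p)) with hG'
  have hsum : ∀ p, F' p (1, 0) + G' p (0, 1) = p.1 • D (e p) v := by
    intro p
    have hv : v = c p.2 • exp (p.2 * I) + s p.2 • (I * exp (p.2 * I)) := by
      apply Complex.ext <;> simp only [hc, hs, Complex.exp_ofReal_mul_I_re,
        Complex.exp_ofReal_mul_I_im, Complex.add_re, Complex.add_im, Complex.smul_re,
        Complex.smul_im, Complex.I_mul_re, Complex.I_mul_im, smul_eq_mul]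
      · linear_combination -v.re * Real.sin_sq_add_cos_sq p.2
      · linear_combination -v.im * Real.sin_sq_add_cos_sq p.2
    have h2 : (p.1 : ℂ) * (I * exp (p.2 * I)) = p.1 • (I * exp (p.2 * I)) := by simp
    conv_rhs => rw [hv]
    simp only [hF', hG', hE, add_apply, smul_apply,
      ContinuousLinearMap.comp_apply, ContinuousLinearMap.smulRight_apply,
      ContinuousLinearMap.coe_fst', ContinuousLinearMap.coe_snd', map_add, map_smul, h2]
    simp
    ring
  have hmem : ∀ p ∈ Ioo (0 : ℝ) 1 ×ˢ Ioo (-Real.pi) Real.pi, e p ∈ ball (0 : ℂ) 1 := by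
    intro p hp
    simp [he, abs_of_pos hp.1.1, hp.1.2]
  have key := integral_divergence_prod_Icc_of_hasFDerivAt_of_le
    (fun p => (p.1 * c p.2) • f (e p)) (fun p => s p.2 • f (e p)) F' G'
    ((0 : ℝ), -Real.pi) (1, Real.pi)
    ⟨zero_le_one, by linarith [Real.pi_pos]⟩
    ((by fun_prop : Continuous fun p : ℝ × ℝ => p.1 * c p.2).continuousOn.smul hfe)
    ((by fun_prop : Continuous fun p : ℝ × ℝ => s p.2).continuousOn.smul hfe)
    (fun p hp => by
      have h1 : HasFDerivAt (fun p : ℝ × ℝ => f (e p)) ((D (e p)).comp (E p)) p :=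
        (hder _ (hmem p hp)).comp p (hasFDerivAt_polar p)
      have h2 : HasFDerivAt (fun p : ℝ × ℝ => c p.2) (s p.2 • ContinuousLinearMap.snd ℝ ℝ ℝ) p :=
        (hcd p.2).comp_hasFDerivAt p hasFDerivAt_snd
      exact (hasFDerivAt_fst.mul h2).smul h1)
    (fun p hp => by
      have h1 : HasFDerivAt (fun p : ℝ × ℝ => f (e p)) ((D (e p)).comp (E p)) p :=
        (hder _ (hmem p hp)).comp p (hasFDerivAt_polar p)
      have h2 : HasFDerivAt (fun p : ℝ × ℝ => s p.2)
          ((-c p.2) • ContinuousLinearMap.snd ℝ ℝ ℝ) p :=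
        (hsd p.2).comp_hasFDerivAt p hasFDerivAt_snd
      exact h2.smul h1)
    (by
      simp only [hsum]
      exact (continuous_fst.continuousOn.smul (hDe.clm_apply continuousOn_const)).integrableOn_compact
        isCompact_Icc)
  simp only [hsum] at key
  have hIcc : (Icc ((0 : ℝ), -Real.pi) (1, Real.pi)) =
      Icc (0 : ℝ) 1 ×ˢ Icc (-Real.pi) Real.pi := by
    rw [Icc_prod_Icc]
  rw [integral_ball_eq_polar, setIntegral_congr_fun (g := fun p => p.1 • D (e p) v)
    (measurableSet_Ioo.prod measurableSet_Ioo), setIntegral_congr_set (t := Icc ((0 : ℝ), -Real.pi)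
    (1, Real.pi)), key]
  -- The sides `θ = ±π` cancel by periodicity, and the side `r = 0` vanishes through the factor `r`;
  -- only the unit circle remains.
  · have h1 : ∀ x : ℝ, s Real.pi • f (e (x, Real.pi)) = s (-Real.pi) • f (e (x, -Real.pi)) := by
      intro x
      have : exp ((Real.pi : ℂ) * I) = exp (-(Real.pi : ℂ) * I) := by
        rw [neg_mul, Complex.exp_neg, Complex.exp_pi_mul_I]; norm_num
      simp [hs, he, this]
    simp only [h1, sub_self, zero_add]
    simp [he, hc]
  · rw [hIcc]
    exact Measure.set_prod_ae_eq Ioo_ae_eq_Icc Ioo_ae_eq_Icc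
  · intro p hp
    have := (hder _ (hmem p hp)).fderiv
    simp only [he] at this ⊢
    rw [this]

lemma hasFDerivAt_of_mem_ball {f : ℂ → ℂ} (hf : DifferentiableOn ℝ f (closedBall 0 1)) {z : ℂ}
    (hz : z ∈ ball (0 : ℂ) 1) : HasFDerivAt f (fderivWithin ℝ f (closedBall 0 1) z) z :=
  (hf z (ball_subset_closedBall hz)).hasFDerivWithinAt.hasFDerivAt
    (mem_of_superset (isOpen_ball.mem_nhds hz) ball_subset_closedBall)

lemma integrableOn_ball_of_continuousOn {f g : ℂ → ℂ} (hg : ContinuousOn g (closedBall 0 1))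
    (h : EqOn f g (ball 0 1)) : IntegrableOn f (ball 0 1) :=
  ((hg.integrableOn_compact (isCompact_closedBall 0 1)).mono_set
    ball_subset_closedBall).congr_fun h.symm measurableSet_ball

lemma integrableOn_ball_fderiv {f : ℂ → ℂ} (hf : ContDiffOn ℝ 1 f (closedBall 0 1)) (v : ℂ) :
    IntegrableOn (fun z => fderiv ℝ f z v) (ball 0 1) :=
  integrableOn_ball_of_continuousOn
    ((hf.continuousOn_fderivWithin uniqueDiffOn_closedBall le_rfl).clm_apply continuousOn_const)
    fun z hz => by
      rw [(hasFDerivAt_of_mem_ball (hf.differentiableOn one_ne_zero) hz).fderiv]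

/-- The Cauchy–Green formula on the unit disc. -/
theorem integral_ball_dzbar {f : ℂ → ℂ} (hf : ContDiffOn ℝ 1 f (closedBall 0 1)) :
    ∫ z in ball (0 : ℂ) 1, dzbar f z =
      1 / 2 * ∫ θ in (-Real.pi)..Real.pi, exp (θ * I) * f (exp (θ * I)) := by
  simp only [dzbar]
  have hc : Continuous fun θ : ℝ => f (exp (θ * I)) :=
    hf.continuousOn.comp_continuous (by fun_prop) exp_mul_I_mem_closedBall
  have hs : ∀ v : ℂ, Continuous fun θ : ℝ =>
      (v.re * Real.cos θ + v.im * Real.sin θ) • f (exp (θ * I)) := fun v =>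
    (by fun_prop : Continuous fun θ : ℝ => v.re * Real.cos θ + v.im * Real.sin θ).smul hc
  rw [integral_div, integral_add (integrableOn_ball_fderiv hf 1)
    ((integrableOn_ball_fderiv hf I).const_mul I), integral_const_mul, integral_ball_fderiv hf,
    integral_ball_fderiv hf, ← intervalIntegral.integral_const_mul,
    ← intervalIntegral.integral_add]
  · rw [div_eq_inv_mul, one_div]
    congr 1
    refine intervalIntegral.integral_congr fun θ _ => ?_
    simp [Complex.exp_mul_I]
    ring
  · exact (hs 1).intervalIntegrable _ _
  · exact (continuous_const.mul (hs I)).intervalIntegrable _ _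

lemma hasDerivAt_exp_mul_I (θ : ℝ) :
    HasDerivAt (fun θ : ℝ => exp (θ * I)) (I * exp (θ * I)) θ := by
  have h := ((hasDerivAt_id (θ : ℂ)).mul_const I).cexp.comp_ofReal
  exact h.congr_deriv (by simp [mul_comm])

/-- The tangential derivative along the unit circle of a function on the closed disc. -/
lemma hasDerivAt_circle {q : ℂ → ℂ} (hq : DifferentiableOn ℝ q (closedBall 0 1)) (θ : ℝ) :
    HasDerivAt (fun θ : ℝ => q (exp (θ * I)))
      (fderivWithin ℝ q (closedBall 0 1) (exp (θ * I)) (I * exp (θ * I))) θ :=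
  (hq _ (exp_mul_I_mem_closedBall θ)).hasFDerivWithinAt.comp_hasDerivAt θ
    (hasDerivAt_exp_mul_I θ) (.of_forall exp_mul_I_mem_closedBall)

lemma continuous_fderivWithin_circle {q : ℂ → ℂ} (hq : ContDiffOn ℝ 1 q (closedBall 0 1)) :
    Continuous fun θ : ℝ =>
      fderivWithin ℝ q (closedBall 0 1) (exp (θ * I)) (I * exp (θ * I)) :=
  ((hq.continuousOn_fderivWithin uniqueDiffOn_closedBall le_rfl).comp_continuous (by fun_prop)
    exp_mul_I_mem_closedBall).clm_apply (by fun_prop)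

/-- Green's formula for the Jacobian of two functions. -/
theorem integral_ball_jacobian {p q : ℂ → ℂ} (hp : ContDiffOn ℝ 1 p (closedBall 0 1))
    (hq : ContDiffOn ℝ 2 q (closedBall 0 1)) :
    ∫ z in ball (0 : ℂ) 1, (dzbar p z * dz q z - dzbar q z * dz p z) =
      -(I / 2) * ∫ θ in (-Real.pi)..Real.pi, p (exp (θ * I)) *
        fderivWithin ℝ q (closedBall 0 1) (exp (θ * I)) (I * exp (θ * I)) := by
  set D := fderivWithin ℝ q (closedBall 0 1) with hD
  have hDc : ContDiffOn ℝ 1 D (closedBall 0 1) :=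
    hq.fderivWithin uniqueDiffOn_closedBall (by norm_num)
  have hf : ∀ v : ℂ, ContDiffOn ℝ 1 (fun z => p z * D z v) (closedBall 0 1) := fun v =>
    hp.mul (hDc.clm_apply contDiffOn_const)
  have hcirc : ∀ v : ℂ, Continuous fun θ : ℝ => p (exp (θ * I)) * D (exp (θ * I)) v := fun v =>
    (hf v).continuousOn.comp_continuous (by fun_prop) exp_mul_I_mem_closedBall
  -- The Jacobian is `(i/2) (∂_y (p q_x) - ∂_x (p q_y))`, where the second derivatives of `q` cancel
  -- by symmetry. Thus `p` needs only one derivative.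
  have hpt : ∀ z ∈ ball (0 : ℂ) 1, dzbar p z * dz q z - dzbar q z * dz p z =
      I / 2 * (fderiv ℝ (fun z => p z * D z 1) z I - fderiv ℝ (fun z => p z * D z I) z 1) := by
    intro z hz
    have hnhds : closedBall (0 : ℂ) 1 ∈ 𝓝 z :=
      mem_of_superset (isOpen_ball.mem_nhds hz) ball_subset_closedBall
    have hp' : DifferentiableAt ℝ p z := (hp.contDiffAt hnhds).differentiableAt one_ne_zero
    have hD' : DifferentiableAt ℝ D z := (hDc.contDiffAt hnhds).differentiableAt one_ne_zero
    have hDq : D =ᶠ[𝓝 z] fderiv ℝ q := by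
      filter_upwards [isOpen_ball.mem_nhds hz] with w hw
      exact ((hasFDerivAt_of_mem_ball (hq.differentiableOn two_ne_zero) hw).fderiv).symm
    have hsymm : fderiv ℝ D z I 1 = fderiv ℝ D z 1 I := by
      rw [hDq.fderiv_eq]
      exact ((hq.contDiffAt hnhds).isSymmSndFDerivAt (by simp)).eq I 1
    have hprod : ∀ v w : ℂ, fderiv ℝ (fun z => p z * D z v) z w =
        p z * fderiv ℝ D z w v + fderiv ℝ p z w * D z v := by
      intro v w
      have h1 : HasFDerivAt (fun z => D z v)
          ((ContinuousLinearMap.apply ℝ ℂ v).comp (fderiv ℝ D z)) z :=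
        (ContinuousLinearMap.apply ℝ ℂ v).hasFDerivAt.comp z hD'.hasFDerivAt
      have h2 : fderiv ℝ (fun z => p z * D z v) z = _ := (hp'.hasFDerivAt.mul h1).fderiv
      rw [h2]
      simp [mul_comm]
    rw [hprod, hprod, hsymm]
    simp only [dz, dzbar, hDq.eq_of_nhds]
    ring
  rw [setIntegral_congr_fun measurableSet_ball hpt, integral_const_mul,
    integral_sub (integrableOn_ball_fderiv (hf 1) I) (integrableOn_ball_fderiv (hf I) 1),
    integral_ball_fderiv (hf 1), integral_ball_fderiv (hf I), ← intervalIntegral.integral_sub,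
    neg_mul, ← mul_neg, ← intervalIntegral.integral_neg]
  · congr 1
    refine intervalIntegral.integral_congr fun θ _ => ?_
    -- The unit tangent vector to the circle, in the real basis `1, I`.
    have h1 : I * exp (θ * I) = (-Real.sin θ) • (1 : ℂ) + Real.cos θ • I := by
      apply Complex.ext <;> simp [Complex.exp_ofReal_mul_I_re, Complex.exp_ofReal_mul_I_im,
        -Complex.ofReal_cos, -Complex.ofReal_sin]
    simp only [h1, map_add, map_smul]
    simp
    ring
  · exact Continuous.intervalIntegrable (by have := hcirc 1; fun_prop) _ _
  · exact Continuous.intervalIntegrable (by have := hcirc I; fun_prop) _ _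

/-! ### Functions holomorphic outside the unit disc -/

/-- A continuous function on the plane that is holomorphic for `|z| > 1` and vanishes at `∞`. -/
structure IsExteriorHolomorphic (v : ℂ → ℂ) : Prop where
  continuous : Continuous v
  holomorphic : DifferentiableOn ℂ v {z | 1 < ‖z‖}
  vanishing : Tendsto v (cocompact ℂ) (𝓝 0)

/-- The function `w ↦ v (1 / w)`, with the value `0` at `w = 0`. -/
def inversion (v : ℂ → ℂ) : ℂ → ℂ := Function.update (fun w => v w⁻¹) 0 0

lemma inversion_of_ne_zero (v : ℂ → ℂ) {w : ℂ} (hw : w ≠ 0) : inversion v w = v w⁻¹ :=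
  Function.update_of_ne hw _ _

/-- The `n`-th moment of `v` on the unit circle. -/
def moment (v : ℂ → ℂ) (n : ℕ) : ℂ :=
  ∫ θ in (-Real.pi)..Real.pi, exp (θ * I) ^ n * v (exp (θ * I))

lemma IsExteriorHolomorphic.continuous_inversion {v : ℂ → ℂ} (h : IsExteriorHolomorphic v) :
    Continuous (inversion v) := by
  rw [continuous_iff_continuousAt]
  intro w
  rcases eq_or_ne w 0 with rfl | hw
  · rw [inversion, continuousAt_update_same]
    refine h.vanishing.comp ?_
    rw [← Metric.cobounded_eq_cocompact]
    exact tendsto_inv₀_nhdsNE_zero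
  · rw [inversion, continuousAt_update_of_ne hw]
    exact h.continuous.continuousAt.comp (continuousAt_inv₀ hw)

/-- Decay at infinity becomes continuity at `0`, so the singularity there is removable. -/
lemma IsExteriorHolomorphic.diffContOnCl_inversion {v : ℂ → ℂ} (h : IsExteriorHolomorphic v) :
    DiffContOnCl ℂ (inversion v) (ball 0 1) := by
  refine ⟨?_, h.continuous_inversion.continuousOn⟩
  rw [← Complex.differentiableOn_compl_singleton_and_continuousAt_iff
    (isOpen_ball.mem_nhds (mem_ball_self one_pos))]
  refine ⟨fun w hw => ?_, h.continuous_inversion.continuousAt⟩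
  have hw0 : w ≠ 0 := hw.2
  have hw1 : ‖w‖ < 1 := by simpa using hw.1
  have hopen : IsOpen {z : ℂ | 1 < ‖z‖} := isOpen_lt continuous_const continuous_norm
  have h1 : DifferentiableAt ℂ v w⁻¹ := h.holomorphic.differentiableAt
    (hopen.mem_nhds (by simpa using (one_lt_inv₀ (norm_pos_iff.2 hw0)).2 hw1))
  have h2 : DifferentiableAt ℂ (fun w => v w⁻¹) w := h1.comp w (differentiableAt_inv hw0)
  refine (h2.congr_of_eventuallyEq ?_).differentiableWithinAt
  filter_upwards [isOpen_ne.mem_nhds hw0] with z hz using inversion_of_ne_zero v hz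

/-- The contour integral over the unit circle, in the angle of the inverse point. -/
lemma circleIntegral_inv_mul (G : ℂ → ℂ) :
    ∮ z in C(0, 1), z⁻¹ * G z = I * ∫ θ in (-Real.pi)..Real.pi, G (exp (θ * I))⁻¹ := by
  have hper : Function.Periodic (fun θ : ℝ => G (exp (θ * I))) (2 * Real.pi) := by
    intro θ
    have : exp ((θ + 2 * Real.pi : ℝ) * I) = exp (θ * I) := by
      push_cast
      rw [add_mul, Complex.exp_add, Complex.exp_two_pi_mul_I, mul_one]
    simp only [this]
  have h1 : ∮ z in C(0, 1), z⁻¹ * G z = ∫ θ in (0 : ℝ)..2 * Real.pi, I * G (exp (θ * I)) := by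
    rw [circleIntegral]
    refine intervalIntegral.integral_congr fun θ _ => ?_
    simp only [deriv_circleMap, circleMap, ofReal_one, one_mul, zero_add, smul_eq_mul]
    field_simp [Complex.exp_ne_zero]
  have h2 := hper.intervalIntegral_add_eq 0 (-Real.pi)
  rw [zero_add, show -Real.pi + 2 * Real.pi = Real.pi by ring] at h2
  rw [h1, intervalIntegral.integral_const_mul, h2]
  congr 1
  have h3 := intervalIntegral.integral_comp_neg (a := -Real.pi) (b := Real.pi)
    (fun θ : ℝ => G (exp (θ * I)))
  rw [neg_neg] at h3
  rw [← h3]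
  refine intervalIntegral.integral_congr fun θ _ => ?_
  simp [Complex.exp_neg]

/-- This is Cauchy's power series on the unit circle itself, where continuity up to the boundary
suffices. The substitution `θ ↦ -θ` turns its coefficients into moments of `v`. -/
lemma IsExteriorHolomorphic.hasSum_inversion {v : ℂ → ℂ} (h : IsExteriorHolomorphic v) {w : ℂ}
    (hw : ‖w‖ < 1) :
    HasSum (fun n : ℕ => (2 * Real.pi : ℂ)⁻¹ * moment v n * w ^ n) (inversion v w) := by
  have h1 := (h.diffContOnCl_inversion.hasFPowerSeriesOnBall (R := 1) one_pos).hasSum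
    (y := w) (by simpa [← ofReal_norm] using hw)
  rw [zero_add] at h1
  refine h1.congr_fun fun n => ?_
  rw [NNReal.coe_one, cauchyPowerSeries_apply]
  have h2 : (∮ z in C(0, 1), (w / (z - 0)) ^ n • (z - 0)⁻¹ • inversion v z) =
      ∮ z in C(0, 1), z⁻¹ * ((w / z) ^ n * inversion v z) := by
    congr 1
    ext z
    simp only [sub_zero, smul_eq_mul]
    ring
  have h3 : (∫ θ in (-Real.pi)..Real.pi, (w / (exp (θ * I))⁻¹) ^ n * inversion v (exp (θ * I))⁻¹) =
      w ^ n * moment v n := by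
    rw [moment, ← intervalIntegral.integral_const_mul]
    refine intervalIntegral.integral_congr fun θ _ => ?_
    rw [inversion_of_ne_zero _ (inv_ne_zero (Complex.exp_ne_zero _)), inv_inv, div_inv_eq_mul,
      mul_pow, mul_assoc]
  rw [h2, circleIntegral_inv_mul fun z => (w / z) ^ n * inversion v z, h3, smul_eq_mul]
  field_simp [Complex.I_ne_zero]

/-- The Laurent expansion at infinity. -/
theorem IsExteriorHolomorphic.hasSum {v : ℂ → ℂ} (h : IsExteriorHolomorphic v) {z : ℂ}
    (hz : 1 < ‖z‖) :
    HasSum (fun n : ℕ => (2 * Real.pi : ℂ)⁻¹ * moment v n * (z ^ n)⁻¹) (v z) := by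
  have hz0 : z ≠ 0 := norm_pos_iff.1 (one_pos.trans hz)
  have := h.hasSum_inversion (w := z⁻¹) (by rw [norm_inv]; exact inv_lt_one_of_one_lt₀ hz)
  rw [inversion_of_ne_zero _ (inv_ne_zero hz0), inv_inv] at this
  simpa only [inv_pow] using this

/-- The boundary values have no modes `e^{ikθ}` with `k > 0`. -/
lemma IsExteriorHolomorphic.integral_inv_pow_mul {v : ℂ → ℂ} (h : IsExteriorHolomorphic v) (k : ℕ) :
    ∫ θ in (-Real.pi)..Real.pi, ((exp (θ * I))⁻¹) ^ (k + 1) * v (exp (θ * I)) = 0 := by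
  -- Cauchy's theorem, after inversion.
  have h1 : ∮ z in C(0, 1), z ^ k * inversion v z = 0 := by
    refine DiffContOnCl.circleIntegral_eq_zero zero_le_one ?_
    exact (((differentiable_id.pow k).diffContOnCl).smul h.diffContOnCl_inversion)
  have h2 : ∮ z in C(0, 1), z ^ k * inversion v z =
      ∮ z in C(0, 1), z⁻¹ * (z ^ (k + 1) * inversion v z) := by
    refine circleIntegral.integral_congr zero_le_one fun z hz => ?_
    have hz0 : z ≠ 0 := by rintro rfl; simp at hz
    field_simp
    ring
  rw [h2, circleIntegral_inv_mul fun z => z ^ (k + 1) * inversion v z] at h1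
  rw [← (mul_eq_zero.1 h1).resolve_left I_ne_zero]
  refine intervalIntegral.integral_congr fun θ _ => ?_
  rw [inversion_of_ne_zero _ (inv_ne_zero (Complex.exp_ne_zero _)), inv_inv]

/-- Integration by parts: the endpoint terms agree by periodicity, and what remains is `n` times the
mode of `v` excluded by `integral_inv_pow_mul`. For `n = 0` the factor `n` itself vanishes. -/
lemma IsExteriorHolomorphic.integral_inv_pow_mul_deriv {v : ℂ → ℂ} (h : IsExteriorHolomorphic v)
    {g : ℝ → ℂ} (hg : Continuous g)
    (hv : ∀ θ : ℝ, HasDerivAt (fun θ : ℝ => v (exp (θ * I))) (g θ) θ) (n : ℕ) :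
    ∫ θ in (-Real.pi)..Real.pi, ((exp (θ * I))⁻¹) ^ n * g θ = 0 := by
  have hpow : ∀ θ : ℝ, ((exp (θ * I))⁻¹) ^ n = exp (θ * (-(n * I))) := by
    intro θ
    rw [← Complex.exp_neg, ← Complex.exp_nat_mul]
    congr 1
    ring
  have hu : ∀ θ : ℝ, HasDerivAt (fun θ : ℝ => ((exp (θ * I))⁻¹) ^ n)
      (-(n * I) * ((exp (θ * I))⁻¹) ^ n) θ := by
    intro θ
    simp only [hpow]
    have h := ((hasDerivAt_id (θ : ℂ)).mul_const (-(n * I))).cexp.comp_ofReal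
    exact h.congr_deriv (by simp [mul_comm])
  have hcont : Continuous fun θ : ℝ => ((exp (θ * I))⁻¹) ^ n := by
    simp only [hpow]
    fun_prop
  rw [intervalIntegral.integral_mul_deriv_eq_deriv_mul (fun θ _ => hu θ) (fun θ _ => hv θ)
    ((continuous_const.mul hcont).intervalIntegrable _ _) (hg.intervalIntegrable _ _)]
  have hexp : exp (((-Real.pi : ℝ) : ℂ) * I) = exp (Real.pi * I) := by
    push_cast
    rw [neg_mul, Complex.exp_neg, Complex.exp_pi_mul_I]
    norm_num
  rw [hexp, sub_self, zero_sub, neg_eq_zero]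
  simp only [mul_assoc]
  rw [intervalIntegral.integral_const_mul]
  rcases n with _ | k
  · simp
  · simp only [h.integral_inv_pow_mul k, mul_zero]

/-- The boundary values of two functions that are holomorphic outside the disc satisfy
`∮ v₁ dv₂ = 0`. -/
theorem IsExteriorHolomorphic.integral_mul_deriv {v₁ v₂ : ℂ → ℂ} (h₁ : IsExteriorHolomorphic v₁)
    (h₂ : IsExteriorHolomorphic v₂) {g : ℝ → ℂ} (hg : Continuous g)
    (hv : ∀ θ : ℝ, HasDerivAt (fun θ : ℝ => v₂ (exp (θ * I))) (g θ) θ) :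
    ∫ θ in (-Real.pi)..Real.pi, v₁ (exp (θ * I)) * g θ = 0 := by
  obtain ⟨C, hC⟩ := (isCompact_uIcc (a := -Real.pi) (b := Real.pi)).exists_bound_of_continuousOn
    hg.continuousOn
  obtain ⟨C', hC'⟩ := (isCompact_closedBall (0 : ℂ) 1).exists_bound_of_continuousOn
    h₁.continuous_inversion.continuousOn
  have hinv : Continuous fun θ : ℝ => (exp (θ * I))⁻¹ := by
    simp only [← Complex.exp_neg]
    fun_prop
  have hmem : ∀ θ ∈ uIoc (-Real.pi) Real.pi, θ ∈ uIcc (-Real.pi) Real.pi := fun θ hθ =>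
    uIoc_subset_uIcc hθ
  -- On the circle itself the series of `v₁` need not converge. Moving to radius `r < 1` after
  -- inversion makes it converge absolutely, so it can be integrated term by term; `r → 1` follows
  -- by dominated convergence.
  have hzero : ∀ r ∈ Ioo (0 : ℝ) 1,
      ∫ θ in (-Real.pi)..Real.pi, inversion v₁ (r * (exp (θ * I))⁻¹) * g θ = 0 := by
    intro r hr
    have hnorm : ∀ θ : ℝ, ‖(r : ℂ) * (exp (θ * I))⁻¹‖ = r := by
      intro θ
      simp [abs_of_pos hr.1]
    set b : ℕ → ℂ := fun n => (2 * Real.pi : ℂ)⁻¹ * moment v₁ n with hb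
    have hsum : Summable fun n : ℕ => ‖b n * (r : ℂ) ^ n‖ :=
      (h₁.hasSum_inversion (w := r) (by simpa [abs_of_pos hr.1] using hr.2)).summable.norm
    have key : HasSum (fun n : ℕ => ∫ θ in (-Real.pi)..Real.pi,
        b n * ((r : ℂ) * (exp (θ * I))⁻¹) ^ n * g θ)
        (∫ θ in (-Real.pi)..Real.pi, inversion v₁ (r * (exp (θ * I))⁻¹) * g θ) := by
      refine intervalIntegral.hasSum_integral_of_dominated_convergence
        (fun n _ => ‖b n * (r : ℂ) ^ n‖ * C) (fun n => ?_) (fun n => ?_) ?_ ?_ ?_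
      · exact Continuous.aestronglyMeasurable (by fun_prop)
      · refine .of_forall fun θ hθ => ?_
        rw [norm_mul]
        refine mul_le_mul ?_ (hC θ (hmem θ hθ)) (norm_nonneg _) (norm_nonneg _)
        rw [norm_mul (b n), norm_mul (b n), norm_pow, norm_pow, hnorm]
        simp [abs_of_pos hr.1]
      · exact .of_forall fun θ _ => hsum.mul_right C
      · exact intervalIntegrable_const
      · refine .of_forall fun θ _ => ?_
        exact (h₁.hasSum_inversion (by rw [hnorm]; exact hr.2)).mul_right (g θ)
    have hterm : ∀ n : ℕ, ∫ θ in (-Real.pi)..Real.pi,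
        b n * ((r : ℂ) * (exp (θ * I))⁻¹) ^ n * g θ = 0 := by
      intro n
      simp only [mul_pow, mul_assoc]
      simp only [intervalIntegral.integral_const_mul, h₂.integral_inv_pow_mul_deriv hg hv,
        mul_zero]
    simp only [hterm] at key
    exact key.unique hasSum_zero
  have hlim : Tendsto (fun r : ℝ => ∫ θ in (-Real.pi)..Real.pi,
      inversion v₁ (r * (exp (θ * I))⁻¹) * g θ) (𝓝[<] 1)
      (𝓝 (∫ θ in (-Real.pi)..Real.pi, v₁ (exp (θ * I)) * g θ)) := by
    have hev : ∀ᶠ r : ℝ in 𝓝[<] 1, r ∈ Ioo (0 : ℝ) 1 := Ioo_mem_nhdsLT one_pos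
    refine intervalIntegral.tendsto_integral_filter_of_dominated_convergence
      (fun _ => C' * C) ?_ ?_ intervalIntegrable_const ?_
    · refine .of_forall fun r => Continuous.aestronglyMeasurable ?_
      exact (h₁.continuous_inversion.comp (continuous_const.mul hinv)).mul hg
    · filter_upwards [hev] with r hr
      refine .of_forall fun θ hθ => ?_
      rw [norm_mul]
      have h1 := hC' ((r : ℂ) * (exp (θ * I))⁻¹) (by simp [abs_of_pos hr.1, hr.2.le])
      exact mul_le_mul h1 (hC θ (hmem θ hθ)) (norm_nonneg _) ((norm_nonneg _).trans h1)
    · refine .of_forall fun θ _ => ?_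
      have h1 : v₁ (exp (θ * I)) = inversion v₁ (((1 : ℝ) : ℂ) * (exp (θ * I))⁻¹) := by
        rw [ofReal_one, one_mul, inversion_of_ne_zero _ (inv_ne_zero (Complex.exp_ne_zero _)),
          inv_inv]
      rw [h1]
      refine Tendsto.mul_const _ ?_
      have h2 : Continuous fun r : ℝ => inversion v₁ ((r : ℂ) * (exp (θ * I))⁻¹) :=
        h₁.continuous_inversion.comp (by fun_prop)
      exact (h2.tendsto 1).mono_left nhdsWithin_le_nhds
  refine tendsto_nhds_unique hlim (Tendsto.congr' ?_ tendsto_const_nhds)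
  filter_upwards [Ioo_mem_nhdsLT (one_pos (α := ℝ))] with r hr
  exact (hzero r hr).symm

/-! ### Regularity in one time -/

section TimeCalculus

variable {𝕜 : Type*} [RCLike 𝕜] {φ : 𝕜 × ℂ → ℂ} {ε : ℝ}

/-- The derivative of `φ` with respect to its first variable, on `ball 0 ε ×ˢ closedBall 0 1`. -/
def velocity (φ : 𝕜 × ℂ → ℂ) (ε : ℝ) (s : 𝕜) (z : ℂ) : ℂ :=
  fderivWithin ℝ φ (ball 0 ε ×ˢ closedBall 0 1) (s, z) (1, 0)

lemma uniqueDiffOn_tube : UniqueDiffOn ℝ (ball (0 : 𝕜) ε ×ˢ closedBall (0 : ℂ) 1) :=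
  isOpen_ball.uniqueDiffOn.prod uniqueDiffOn_closedBall

lemma contDiffOn_fderivWithin_tube
    (hφ : ContDiffOn ℝ 2 φ (ball 0 ε ×ˢ closedBall 0 1)) :
    ContDiffOn ℝ 1 (fderivWithin ℝ φ (ball 0 ε ×ˢ closedBall 0 1))
      (ball 0 ε ×ˢ closedBall 0 1) :=
  hφ.fderivWithin uniqueDiffOn_tube (by norm_num)

lemma contDiffOn_velocity (hφ : ContDiffOn ℝ 2 φ (ball 0 ε ×ˢ closedBall 0 1)) {s : 𝕜}
    (hs : s ∈ ball (0 : 𝕜) ε) : ContDiffOn ℝ 1 (velocity φ ε s) (closedBall 0 1) :=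
  ((contDiffOn_fderivWithin_tube hφ).comp (contDiffOn_const.prodMk contDiffOn_id)
    fun _ hz => ⟨hs, hz⟩).clm_apply contDiffOn_const

lemma tube_mem_nhds {s : 𝕜} (hs : s ∈ ball (0 : 𝕜) ε) {z : ℂ} (hz : z ∈ ball (0 : ℂ) 1) :
    ball (0 : 𝕜) ε ×ˢ closedBall (0 : ℂ) 1 ∈ 𝓝 (s, z) :=
  prod_mem_nhds (isOpen_ball.mem_nhds hs)
    (mem_of_superset (isOpen_ball.mem_nhds hz) ball_subset_closedBall)

lemma fderiv_slice (hφ : ContDiffOn ℝ 2 φ (ball 0 ε ×ˢ closedBall 0 1)) {s : 𝕜}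
    (hs : s ∈ ball (0 : 𝕜) ε) {z : ℂ} (hz : z ∈ ball (0 : ℂ) 1) (v : ℂ) :
    fderiv ℝ (fun w => φ (s, w)) z v =
      fderivWithin ℝ φ (ball 0 ε ×ˢ closedBall 0 1) (s, z) (0, v) := by
  have h1 : HasFDerivAt φ (fderivWithin ℝ φ (ball 0 ε ×ˢ closedBall 0 1) (s, z)) (s, z) :=
    (hφ.differentiableOn two_ne_zero _
      (mem_of_mem_nhds (tube_mem_nhds hs hz))).hasFDerivWithinAt.hasFDerivAt (tube_mem_nhds hs hz)
  have h2 : HasFDerivAt (fun w => φ (s, w)) _ z := h1.comp z (hasFDerivAt_prodMk_right s z)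
  rw [h2.fderiv]
  simp

lemma fderiv_velocity (hφ : ContDiffOn ℝ 2 φ (ball 0 ε ×ˢ closedBall 0 1)) {s : 𝕜}
    (hs : s ∈ ball (0 : 𝕜) ε) {z : ℂ} (hz : z ∈ ball (0 : ℂ) 1) (v : ℂ) :
    fderiv ℝ (velocity φ ε s) z v =
      fderivWithin ℝ (fderivWithin ℝ φ (ball 0 ε ×ˢ closedBall 0 1))
        (ball 0 ε ×ˢ closedBall 0 1) (s, z) (0, v) (1, 0) := by
  have h1 := ((contDiffOn_fderivWithin_tube hφ).differentiableOn one_ne_zero _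
    (mem_of_mem_nhds (tube_mem_nhds hs hz))).hasFDerivWithinAt.hasFDerivAt (tube_mem_nhds hs hz)
  have h2 := h1.comp z (hasFDerivAt_prodMk_right s z)
  have h3 : HasFDerivAt (velocity φ ε s) _ z :=
    (ContinuousLinearMap.apply ℝ ℂ ((1 : 𝕜), (0 : ℂ))).hasFDerivAt.comp z h2
  rw [h3.fderiv]
  simp

/-- Compactness of the smaller tube of radius `ε / 2` bounds the first and second derivatives. These
uniform bounds justify differentiation under the integral sign. -/
lemma exists_bound_slice (hε : 0 < ε) (hφ : ContDiffOn ℝ 2 φ (ball 0 ε ×ˢ closedBall 0 1)) :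
    ∃ C : ℝ, ∀ s ∈ ball (0 : 𝕜) (ε / 2),
      (∀ z ∈ closedBall (0 : ℂ) 1, ‖velocity φ ε s z‖ ≤ C) ∧
      ∀ z ∈ ball (0 : ℂ) 1, ∀ v : ℂ, ‖v‖ ≤ 1 →
        ‖fderiv ℝ (fun w => φ (s, w)) z v‖ ≤ C ∧ ‖fderiv ℝ (velocity φ ε s) z v‖ ≤ C := by
  have hK : IsCompact (closedBall (0 : 𝕜) (ε / 2) ×ˢ closedBall (0 : ℂ) 1) :=
    (isCompact_closedBall _ _).prod (isCompact_closedBall _ _)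
  have hsub : closedBall (0 : 𝕜) (ε / 2) ×ˢ closedBall (0 : ℂ) 1 ⊆
      ball (0 : 𝕜) ε ×ˢ closedBall (0 : ℂ) 1 :=
    prod_mono (closedBall_subset_ball (by linarith)) subset_rfl
  obtain ⟨C₁, hC₁⟩ := hK.exists_bound_of_continuousOn
    ((contDiffOn_fderivWithin_tube hφ).continuousOn.mono hsub)
  obtain ⟨C₂, hC₂⟩ := hK.exists_bound_of_continuousOn
    (((contDiffOn_fderivWithin_tube hφ).continuousOn_fderivWithin uniqueDiffOn_tube le_rfl).mono
      hsub)
  have hone : ‖((1 : 𝕜), (0 : ℂ))‖ ≤ 1 := by simp [Prod.norm_def]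
  have hpair : ∀ v : ℂ, ‖v‖ ≤ 1 → ‖((0 : 𝕜), v)‖ ≤ 1 := fun v hv => by simp [Prod.norm_def, hv]
  refine ⟨max C₁ C₂, fun s hs => ⟨fun z hz => ?_, fun z hz v hv => ?_⟩⟩
  · exact (ContinuousLinearMap.unit_le_opNorm _ _ hone).trans
      ((hC₁ (s, z) ⟨ball_subset_closedBall hs, hz⟩).trans (le_max_left _ _))
  · have hs' : s ∈ ball (0 : 𝕜) ε := ball_subset_ball (by linarith) hs
    have hmem : (s, z) ∈ closedBall (0 : 𝕜) (ε / 2) ×ˢ closedBall (0 : ℂ) 1 :=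
      ⟨ball_subset_closedBall hs, ball_subset_closedBall hz⟩
    rw [fderiv_slice hφ hs' hz, fderiv_velocity hφ hs' hz]
    exact ⟨(ContinuousLinearMap.unit_le_opNorm _ _ (hpair v hv)).trans
        ((hC₁ _ hmem).trans (le_max_left _ _)),
      (ContinuousLinearMap.unit_le_opNorm _ _ hone).trans
        ((ContinuousLinearMap.unit_le_opNorm _ _ (hpair v hv)).trans
          ((hC₂ _ hmem).trans (le_max_right _ _)))⟩

variable [NormedAlgebra 𝕜 ℂ] [IsScalarTower ℝ 𝕜 ℂ]

/-- By uniqueness of the real derivative, it is the `𝕜`-derivative with scalars restricted. The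
second part, linearity over `𝕜` in the time increment, matters for complex times. -/
lemma hasDerivAt_time_and_fderivWithin (hφ : ContDiffOn ℝ 2 φ (ball 0 ε ×ˢ closedBall 0 1)) {z : ℂ}
    (hz : z ∈ closedBall (0 : ℂ) 1) (hd : DifferentiableOn 𝕜 (fun s => φ (s, z)) (ball 0 ε))
    {s : 𝕜} (hs : s ∈ ball (0 : 𝕜) ε) :
    HasDerivAt (fun s => φ (s, z)) (velocity φ ε s z) s ∧
      ∀ δ : 𝕜, fderivWithin ℝ φ (ball 0 ε ×ˢ closedBall 0 1) (s, z) (δ, 0) =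
        δ • velocity φ ε s z := by
  have h1 : HasFDerivAt (fun s => φ (s, z))
      ((fderivWithin ℝ φ (ball 0 ε ×ˢ closedBall 0 1) (s, z)).comp
        (ContinuousLinearMap.inl ℝ 𝕜 ℂ)) s := by
    refine (hφ.differentiableOn two_ne_zero (s, z)
      ⟨hs, hz⟩).hasFDerivWithinAt.comp_hasFDerivAt s (hasFDerivAt_prodMk_left s z) ?_
    filter_upwards [isOpen_ball.mem_nhds hs] with s' hs' using ⟨hs', hz⟩
  have h2 : HasDerivAt (fun s => φ (s, z)) (deriv (fun s => φ (s, z)) s) s :=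
    (hd.differentiableAt (isOpen_ball.mem_nhds hs)).hasDerivAt
  have h3 := (h2.hasFDerivAt.restrictScalars ℝ).unique h1
  have h4 : ∀ δ : 𝕜, fderivWithin ℝ φ (ball 0 ε ×ˢ closedBall 0 1) (s, z) (δ, 0) =
      δ • deriv (fun s => φ (s, z)) s := by
    intro δ
    have := DFunLike.congr_fun h3 δ
    simpa using this.symm
  have h5 : velocity φ ε s z = deriv (fun s => φ (s, z)) s := by
    rw [velocity, h4, one_smul]
  rw [h5]
  exact ⟨h2, h4⟩

/-- Time and space derivatives commute by symmetry of the second derivative. Differentiability over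
`𝕜` survives because the identity `D (s, w) (δ, 0) = δ • velocity φ ε s w` can be differentiated in
`w`. -/
lemma hasDerivAt_fderiv_slice (hφ : ContDiffOn ℝ 2 φ (ball 0 ε ×ˢ closedBall 0 1))
    (hd : ∀ z ∈ closedBall (0 : ℂ) 1, DifferentiableOn 𝕜 (fun s => φ (s, z)) (ball 0 ε))
    {s : 𝕜} (hs : s ∈ ball (0 : 𝕜) ε) {z : ℂ} (hz : z ∈ ball (0 : ℂ) 1) (v : ℂ) :
    HasDerivAt (fun s => fderiv ℝ (fun w => φ (s, w)) z v) (fderiv ℝ (velocity φ ε s) z v) s := by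
  set D := fderivWithin ℝ φ (ball 0 ε ×ˢ closedBall 0 1) with hD
  have hnhds := tube_mem_nhds hs hz
  have hDd : HasFDerivAt D (fderiv ℝ D (s, z)) (s, z) :=
    (((contDiffOn_fderivWithin_tube hφ).contDiffAt hnhds).differentiableAt
      one_ne_zero).hasFDerivAt
  have hDφ : D =ᶠ[𝓝 (s, z)] fderiv ℝ φ := by
    filter_upwards [(isOpen_ball.prod isOpen_ball).mem_nhds
      (show (s, z) ∈ ball (0 : 𝕜) ε ×ˢ ball (0 : ℂ) 1 from ⟨hs, hz⟩)] with a ha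
    exact fderivWithin_of_mem_nhds (tube_mem_nhds ha.1 ha.2)
  have hsymm : ∀ a b, fderiv ℝ D (s, z) a b = fderiv ℝ D (s, z) b a := by
    rw [hDφ.fderiv_eq]
    exact ((hφ.contDiffAt hnhds).isSymmSndFDerivAt (by simp)).eq
  have hslice : ∀ δ : 𝕜, fderiv ℝ D (s, z) (0, v) (δ, 0) =
      δ • fderiv ℝ (velocity φ ε s) z v := by
    intro δ
    have h1 : HasFDerivAt (fun w => D (s, w) (δ, 0)) _ z :=
      (ContinuousLinearMap.apply ℝ ℂ (δ, (0 : ℂ))).hasFDerivAt.comp z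
        (hDd.comp z (hasFDerivAt_prodMk_right s z))
    have h2 : (fun w => D (s, w) (δ, 0)) =ᶠ[𝓝 z] fun w => δ • velocity φ ε s w := by
      filter_upwards [isOpen_ball.mem_nhds hz] with w hw
      exact (hasDerivAt_time_and_fderivWithin hφ (ball_subset_closedBall hw)
        (hd w (ball_subset_closedBall hw)) hs).2 δ
    have h3 : DifferentiableAt ℝ (velocity φ ε s) z :=
      ((contDiffOn_velocity hφ hs).contDiffAt
        (mem_of_superset (isOpen_ball.mem_nhds hz) ball_subset_closedBall)).differentiableAt
          one_ne_zero
    have h4 := h1.fderiv.symm.trans h2.fderiv_eq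
    have h5 : fderiv ℝ (fun w => δ • velocity φ ε s w) z = _ := (h3.hasFDerivAt.const_smul δ).fderiv
    rw [h5] at h4
    have h6 := DFunLike.congr_fun h4 v
    simpa using h6
  have h1 : HasFDerivAt (fun s' => D (s', z) (0, v)) _ s :=
    (ContinuousLinearMap.apply ℝ ℂ ((0 : 𝕜), v)).hasFDerivAt.comp s
      (hDd.comp s (hasFDerivAt_prodMk_left s z))
  have h2 : HasDerivAt (fun s' => D (s', z) (0, v)) (fderiv ℝ (velocity φ ε s) z v) s := by
    refine hasDerivAt_iff_hasFDerivAt.2 (hasFDerivAt_of_restrictScalars ℝ h1 ?_)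
    refine ContinuousLinearMap.ext fun δ => ?_
    have h3 := hsymm (δ, 0) (0, v)
    rw [hslice] at h3
    simpa using h3.symm
  refine h2.congr_of_eventuallyEq ?_
  filter_upwards [isOpen_ball.mem_nhds hs] with s' hs'
  exact fderiv_slice hφ hs' hz v

end TimeCalculus

/-! ### Wirtinger derivatives -/

lemma dz_add {f g : ℂ → ℂ} {z : ℂ} (hf : DifferentiableAt ℝ f z) (hg : DifferentiableAt ℝ g z) :
    dz (fun w => f w + g w) z = dz f z + dz g z := by
  simp only [dz, fderiv_fun_add hf hg, add_apply]
  ring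

lemma dzbar_add {f g : ℂ → ℂ} {z : ℂ} (hf : DifferentiableAt ℝ f z)
    (hg : DifferentiableAt ℝ g z) : dzbar (fun w => f w + g w) z = dzbar f z + dzbar g z := by
  simp only [dzbar, fderiv_fun_add hf hg, add_apply]
  ring

lemma fderiv_real_apply {f : ℂ → ℂ} {z : ℂ} (hf : DifferentiableAt ℂ f z) (v : ℂ) :
    fderiv ℝ f z v = v * deriv f z := by
  rw [hf.fderiv_restrictScalars ℝ]
  simp

lemma dz_of_differentiableAt {f : ℂ → ℂ} {z : ℂ} (hf : DifferentiableAt ℂ f z) :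
    dz f z = deriv f z := by
  rw [dz, fderiv_real_apply hf, fderiv_real_apply hf]
  linear_combination (-deriv f z / 2) * I_mul_I

lemma dzbar_of_differentiableAt {f : ℂ → ℂ} {z : ℂ} (hf : DifferentiableAt ℂ f z) :
    dzbar f z = 0 := by
  rw [dzbar, fderiv_real_apply hf, fderiv_real_apply hf]
  linear_combination (deriv f z / 2) * I_mul_I

lemma dzbar_mul_of_differentiableAt {f g : ℂ → ℂ} {z : ℂ} (hf : DifferentiableAt ℝ f z)
    (hg : DifferentiableAt ℂ g z) : dzbar (fun w => f w * g w) z = dzbar f z * g z := by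
  have hg0 := dzbar_of_differentiableAt hg
  simp only [dzbar, fderiv_fun_mul hf (hg.restrictScalars ℝ), add_apply, smul_apply, smul_eq_mul]
    at hg0 ⊢
  linear_combination f z * hg0

lemma fderiv_neg_comp_neg (f : ℂ → ℂ) (z v : ℂ) :
    fderiv ℝ (fun w => -f (-w)) z v = fderiv ℝ f (-z) v := by
  have h := (ContinuousLinearEquiv.neg ℝ (M := ℂ)).comp_right_fderiv (f := f) (x := z)
  have h1 : fderiv ℝ (fun w => f (-w)) z v = -fderiv ℝ f (-z) v := by
    have := DFunLike.congr_fun h v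
    simpa [Function.comp_def] using this
  rw [fderiv_fun_neg, neg_apply, h1, neg_neg]

lemma dz_neg_comp_neg (f : ℂ → ℂ) (z : ℂ) : dz (fun w => -f (-w)) z = dz f (-z) := by
  simp only [dz, fderiv_neg_comp_neg]

lemma dzbar_neg_comp_neg (f : ℂ → ℂ) (z : ℂ) : dzbar (fun w => -f (-w)) z = dzbar f (-z) := by
  simp only [dzbar, fderiv_neg_comp_neg]

lemma norm_dz_le {f : ℂ → ℂ} {z : ℂ} {C : ℝ} (h : ∀ v : ℂ, ‖v‖ ≤ 1 → ‖fderiv ℝ f z v‖ ≤ C) :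
    ‖dz f z‖ ≤ C := by
  have h1 := h 1 (by simp)
  have h2 := h I (by simp)
  rw [dz, norm_div, Complex.norm_ofNat, div_le_iff₀ two_pos]
  refine (norm_sub_le _ _).trans ?_
  rw [norm_mul, norm_I, one_mul]
  linarith

lemma norm_dzbar_le {f : ℂ → ℂ} {z : ℂ} {C : ℝ} (h : ∀ v : ℂ, ‖v‖ ≤ 1 → ‖fderiv ℝ f z v‖ ≤ C) :
    ‖dzbar f z‖ ≤ C := by
  have h1 := h 1 (by simp)
  have h2 := h I (by simp)
  rw [dzbar, norm_div, Complex.norm_ofNat, div_le_iff₀ two_pos]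
  refine (norm_add_le _ _).trans ?_
  rw [norm_mul, norm_I, one_mul]
  linarith

/-- The full derivative in `dz` is uncontrolled on the boundary circle. The derivative within the
closed disc replaces it there, and its continuity on a compact set yields integrability. -/
lemma exists_continuousOn_eqOn_dz {f : ℂ → ℂ} (hf : ContDiffOn ℝ 1 f (closedBall 0 1)) :
    ∃ g, ContinuousOn g (closedBall (0 : ℂ) 1) ∧ EqOn (dz f) g (ball 0 1) := by
  have hc := hf.continuousOn_fderivWithin uniqueDiffOn_closedBall le_rfl
  refine ⟨fun z => (fderivWithin ℝ f (closedBall 0 1) z 1 -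
    I * fderivWithin ℝ f (closedBall 0 1) z I) / 2, ?_, fun z hz => ?_⟩
  · exact ((hc.clm_apply continuousOn_const).sub
      (continuousOn_const.mul (hc.clm_apply continuousOn_const))).div_const 2
  · rw [dz, (hasFDerivAt_of_mem_ball (hf.differentiableOn one_ne_zero) hz).fderiv]

lemma exists_continuousOn_eqOn_dzbar {f : ℂ → ℂ} (hf : ContDiffOn ℝ 1 f (closedBall 0 1)) :
    ∃ g, ContinuousOn g (closedBall (0 : ℂ) 1) ∧ EqOn (dzbar f) g (ball 0 1) := by
  have hc := hf.continuousOn_fderivWithin uniqueDiffOn_closedBall le_rfl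
  refine ⟨fun z => (fderivWithin ℝ f (closedBall 0 1) z 1 +
    I * fderivWithin ℝ f (closedBall 0 1) z I) / 2, ?_, fun z hz => ?_⟩
  · exact ((hc.clm_apply continuousOn_const).add
      (continuousOn_const.mul (hc.clm_apply continuousOn_const))).div_const 2
  · rw [dzbar, (hasFDerivAt_of_mem_ball (hf.differentiableOn one_ne_zero) hz).fderiv]

lemma integrableOn_dzbar_mul_dz {f g : ℂ → ℂ} (hf : ContDiffOn ℝ 1 f (closedBall 0 1))
    (hg : ContDiffOn ℝ 1 g (closedBall 0 1)) :
    IntegrableOn (fun z => dzbar f z * dz g z) (ball 0 1) := by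
  obtain ⟨f', hf', hff'⟩ := exists_continuousOn_eqOn_dzbar hf
  obtain ⟨g', hg', hgg'⟩ := exists_continuousOn_eqOn_dz hg
  exact integrableOn_ball_of_continuousOn (hf'.mul hg') fun z hz => by
    simp only [hff' hz, hgg' hz, Pi.mul_apply]

lemma integrableOn_dzbar_mul {f g : ℂ → ℂ} (hf : ContDiffOn ℝ 1 f (closedBall 0 1))
    (hg : Continuous g) : IntegrableOn (fun z => dzbar f z * g z) (ball 0 1) := by
  obtain ⟨f', hf', hff'⟩ := exists_continuousOn_eqOn_dzbar hf
  exact integrableOn_ball_of_continuousOn (hf'.mul hg.continuousOn) fun z hz => by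
    simp only [hff' hz, Pi.mul_apply]

section HasTimeDerivative

variable {𝕜 : Type*} [RCLike 𝕜] [NormedAlgebra 𝕜 ℂ] [IsScalarTower ℝ 𝕜 ℂ] {φ : 𝕜 × ℂ → ℂ} {ε : ℝ}

lemma hasDerivAt_dz_slice (hφ : ContDiffOn ℝ 2 φ (ball 0 ε ×ˢ closedBall 0 1))
    (hd : ∀ z ∈ closedBall (0 : ℂ) 1, DifferentiableOn 𝕜 (fun s => φ (s, z)) (ball 0 ε))
    {s : 𝕜} (hs : s ∈ ball (0 : 𝕜) ε) {z : ℂ} (hz : z ∈ ball (0 : ℂ) 1) :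
    HasDerivAt (fun s => dz (fun w => φ (s, w)) z) (dz (velocity φ ε s) z) s := by
  have h := fun v => hasDerivAt_fderiv_slice hφ hd hs hz v
  exact ((h 1).sub ((h I).const_mul I)).div_const 2

lemma hasDerivAt_dzbar_slice (hφ : ContDiffOn ℝ 2 φ (ball 0 ε ×ˢ closedBall 0 1))
    (hd : ∀ z ∈ closedBall (0 : ℂ) 1, DifferentiableOn 𝕜 (fun s => φ (s, z)) (ball 0 ε))
    {s : 𝕜} (hs : s ∈ ball (0 : 𝕜) ε) {z : ℂ} (hz : z ∈ ball (0 : ℂ) 1) :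
    HasDerivAt (fun s => dzbar (fun w => φ (s, w)) z) (dzbar (velocity φ ε s) z) s := by
  have h := fun v => hasDerivAt_fderiv_slice hφ hd hs hz v
  exact ((h 1).add ((h I).const_mul I)).div_const 2

end HasTimeDerivative

/-! ### The function `S₀` -/

section Series

variable {𝕜 : Type*} [RCLike 𝕜] [NormedAlgebra 𝕜 ℂ]

lemma S₀_neg (t : ℕ → 𝕜) (z : ℂ) : S₀ t (-z) = -S₀ t z := by
  rw [S₀, S₀, ← tsum_neg]
  refine tsum_congr fun n => ?_
  rw [Odd.neg_pow ⟨n, rfl⟩, smul_neg]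

lemma Admissible.summable {t : ℕ → 𝕜} (ht : Admissible t) {z : ℂ} (hz : ‖z‖ ≤ 1) :
    Summable fun n : ℕ => t n • z ^ (2 * n + 1) := by
  obtain ⟨R, hR, hs⟩ := ht
  refine hs.of_norm_bounded fun n => ?_
  rw [norm_smul, norm_pow]
  gcongr
  exact hz.trans hR.le

lemma Admissible.differentiableAt_S₀ {t : ℕ → 𝕜} (ht : Admissible t) {z : ℂ} (hz : ‖z‖ ≤ 1) :
    DifferentiableAt ℂ (S₀ t) z := by
  obtain ⟨R, hR, hs⟩ := ht
  have h : DifferentiableOn ℂ (fun w : ℂ => ∑' n : ℕ, t n • w ^ (2 * n + 1)) (ball 0 R) := by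
    refine differentiableOn_tsum_of_summable_norm hs (fun n => ?_) isOpen_ball fun n w hw => ?_
    · simp only [Algebra.smul_def]
      fun_prop
    · rw [norm_smul, norm_pow]
      gcongr
      exact (mem_ball_zero_iff.1 hw).le
  exact h.differentiableAt (isOpen_ball.mem_nhds (mem_ball_zero_iff.2 (hz.trans_lt hR)))

lemma S₀_add_single {t : ℕ → 𝕜} (ht : Admissible t) (n : ℕ) (s : 𝕜) {z : ℂ} (hz : ‖z‖ ≤ 1) :
    S₀ (t + Pi.single n s) z = S₀ t z + s • z ^ (2 * n + 1) := by
  have h1 : HasSum (fun m : ℕ => (Pi.single n s : ℕ → 𝕜) m • z ^ (2 * m + 1))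
      (s • z ^ (2 * n + 1)) := by
    have := hasSum_single (f := fun m : ℕ => (Pi.single n s : ℕ → 𝕜) m • z ^ (2 * m + 1)) n
      fun m hm => by simp [Pi.single_eq_of_ne hm]
    simpa using this
  have h2 := ((ht.summable hz).hasSum.add h1).tsum_eq
  rw [S₀, S₀, ← h2]
  simp only [Pi.add_apply, add_smul]

lemma Admissible.dz_S₀_add_single {t : ℕ → 𝕜} (ht : Admissible t) (n : ℕ) (s : 𝕜) {z : ℂ}
    (hz : ‖z‖ < 1) :
    dz (S₀ (t + Pi.single n s)) z = deriv (S₀ t) z + s • ((2 * n + 1) * z ^ (2 * n)) := by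
  have h1 : HasDerivAt (fun w => S₀ t w + s • w ^ (2 * n + 1))
      (deriv (S₀ t) z + s • ((2 * n + 1) * z ^ (2 * n))) z := by
    refine (ht.differentiableAt_S₀ hz.le).hasDerivAt.add ?_
    simp only [Algebra.smul_def]
    refine ((hasDerivAt_pow (2 * n + 1) z).const_mul _).congr_deriv ?_
    push_cast
    simp
  have h2 : S₀ (t + Pi.single n s) =ᶠ[𝓝 z] fun w => S₀ t w + s • w ^ (2 * n + 1) := by
    filter_upwards [isOpen_ball.mem_nhds (mem_ball_zero_iff.2 hz)] with w hw
    exact S₀_add_single ht n s (mem_ball_zero_iff.1 hw).le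
  have h3 := h1.congr_of_eventuallyEq h2
  rw [dz_of_differentiableAt h3.differentiableAt, h3.deriv]

end Series

/-! ### Solutions -/

section Solutions

variable {𝕜 : Type*} [RCLike 𝕜] [NormedAlgebra 𝕜 ℂ] {Ω : Set (ℂ × ℂ)} {W : ℂ → ℂ → ℂ}
  {t : ℕ → 𝕜} {v : ℂ → ℂ}

lemma IsSolution.isExteriorHolomorphic (h : IsSolution Ω W t v) : IsExteriorHolomorphic v :=
  ⟨h.continuous, h.holomorphic, h.vanishing⟩

lemma IsSolution.contDiffOn_one (h : IsSolution Ω W t v) : ContDiffOn ℝ 1 v (closedBall 0 1) :=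
  h.regular.of_le one_le_two

lemma IsSolution.differentiableAt (h : IsSolution Ω W t v) {z : ℂ} (hz : z ∈ ball (0 : ℂ) 1) :
    DifferentiableAt ℝ v z :=
  (hasFDerivAt_of_mem_ball (h.regular.differentiableOn two_ne_zero) hz).differentiableAt

lemma IsSolution.dz_S₀_add (h : IsSolution Ω W t v) (ht : Admissible t) {z : ℂ}
    (hz : z ∈ ball (0 : ℂ) 1) : dz (fun w => S₀ t w + v w) z = dz (S₀ t) z + dz v z :=
  dz_add ((ht.differentiableAt_S₀ (mem_ball_zero_iff.1 hz).le).restrictScalars ℝ)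
    (h.differentiableAt hz)

lemma IsSolution.dzbar_S₀_add (h : IsSolution Ω W t v) (ht : Admissible t) {z : ℂ}
    (hz : z ∈ ball (0 : ℂ) 1) : dzbar (fun w => S₀ t w + v w) z = dzbar v z := by
  have h1 := ht.differentiableAt_S₀ (mem_ball_zero_iff.1 hz).le
  rw [dzbar_add (h1.restrictScalars ℝ) (h.differentiableAt hz), dzbar_of_differentiableAt h1,
    zero_add]

/-- The symmetry `z ↦ -z` of the data maps solutions to solutions. -/
lemma IsSolution.neg_comp_neg (h : IsSolution Ω W t v)
    (hΩ : ∀ z η : ℂ, ‖z‖ < 1 → (z, η) ∈ Ω → (-z, η) ∈ Ω)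
    (hW : ∀ z η : ℂ, ‖z‖ < 1 → (z, η) ∈ Ω → W (-z) η = W z η) :
    IsSolution Ω W t (fun z => -v (-z)) := by
  have hS : (fun w => S₀ t w + -v (-w)) = fun w => -((fun w => S₀ t w + v w) (-w)) := by
    ext w
    simp only [S₀_neg]
    ring
  have hdz : ∀ z, dz (fun w => S₀ t w + -v (-w)) z = dz (fun w => S₀ t w + v w) (-z) := fun z => by
    rw [hS]
    exact dz_neg_comp_neg (fun w => S₀ t w + v w) z
  have hdzbar : ∀ z, dzbar (fun w => S₀ t w + -v (-w)) z = dzbar (fun w => S₀ t w + v w) (-z) :=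
    fun z => by
      rw [hS]
      exact dzbar_neg_comp_neg (fun w => S₀ t w + v w) z
  refine ⟨(h.continuous.comp continuous_neg).neg, ?_, ?_, ?_, fun z hz => ?_, fun z hz => ?_⟩
  · exact (h.regular.comp contDiff_neg.contDiffOn fun z hz => by simpa using hz).neg
  · exact (h.holomorphic.comp differentiable_neg.differentiableOn fun z hz => by
      simpa using hz).neg
  · have hneg : Tendsto (fun z : ℂ => -z) (cocompact ℂ) (cocompact ℂ) :=
      (Homeomorph.neg ℂ).isClosedEmbedding.tendsto_cocompact
    simpa using (h.vanishing.comp hneg).neg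
  · have := hΩ _ _ (by simpa using hz) (h.mem_domain (-z) (by simpa using hz))
    rwa [neg_neg, ← hdz] at this
  · have hz' : ‖-z‖ < 1 := by simpa using hz
    -- The symmetry of `W` is applied at `z`, so membership in `Ω` is first carried over from `-z`.
    rw [hdz, hdzbar, h.beltrami (-z) hz', hW _ _ hz (by
      simpa using hΩ _ _ hz' (h.mem_domain (-z) hz'))]

/-- The Laurent expansion at infinity of an odd function. -/
lemma IsExteriorHolomorphic.hasSum_of_odd (h : IsExteriorHolomorphic v) (hodd : ∀ z, v (-z) = -v z)
    {z : ℂ} (hz : 1 < ‖z‖) :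
    HasSum (fun n : ℕ => (2 * Real.pi : ℂ)⁻¹ * moment v (2 * n + 1) * (z ^ (2 * n + 1))⁻¹)
      (v z) := by
  have h1 := h.hasSum hz
  have h2 := h.hasSum (z := -z) (by simpa using hz)
  -- Half the difference of the expansions at `z` and `-z`: the even powers drop out.
  have h3 := (h1.sub h2).div_const 2
  rw [hodd, sub_neg_eq_add, add_self_div_two] at h3
  have hinj : Function.Injective fun n : ℕ => 2 * n + 1 := fun a b hab => by
    simpa using hab
  rw [← hinj.hasSum_iff] at h3
  · refine h3.congr_fun fun n => ?_
    simp only [Function.comp_apply, Odd.neg_pow (⟨n, rfl⟩ : Odd (2 * n + 1)), inv_neg]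
    ring
  · intro m hm
    have hm' : Even m := by
      rw [← Nat.not_odd_iff_even]
      rintro ⟨k, rfl⟩
      exact hm ⟨k, rfl⟩
    simp [hm'.neg_pow]

end Solutions

/-! ### The variation of the action -/

section Variation

variable {𝕜 : Type*} [RCLike 𝕜] [NormedAlgebra 𝕜 ℂ] [IsScalarTower ℝ 𝕜 ℂ]

/-- The velocity of a family of functions that are holomorphic outside the disc and vanish at
infinity is orthogonal to the tangential derivatives of such functions. -/
lemma integral_velocity_mul_deriv {φ : 𝕜 × ℂ → ℂ} {ε : ℝ} (hε : 0 < ε)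
    (hφ : ContDiffOn ℝ 2 φ (ball 0 ε ×ˢ closedBall 0 1))
    (hd : ∀ z ∈ closedBall (0 : ℂ) 1, DifferentiableOn 𝕜 (fun s => φ (s, z)) (ball 0 ε))
    (hext : ∀ᶠ s : 𝕜 in 𝓝 0, IsExteriorHolomorphic fun w => φ (s, w))
    {v : ℂ → ℂ} (hv : IsExteriorHolomorphic v) {g : ℝ → ℂ} (hg : Continuous g)
    (hvg : ∀ θ : ℝ, HasDerivAt (fun θ : ℝ => v (exp (θ * I))) (g θ) θ) :
    ∫ θ in (-Real.pi)..Real.pi, velocity φ ε (0 : 𝕜) (exp (θ * I)) * g θ = 0 := by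
  obtain ⟨C, hC⟩ := exists_bound_slice hε hφ
  have h0 : (0 : 𝕜) ∈ ball (0 : 𝕜) ε := mem_ball_self hε
  have hball : ball (0 : 𝕜) (ε / 2) ∈ 𝓝 (0 : 𝕜) := ball_mem_nhds _ (half_pos hε)
  have hcont : ∀ s : 𝕜, IsExteriorHolomorphic (fun w => φ (s, w)) →
      Continuous fun θ : ℝ => φ (s, exp (θ * I)) * g θ := fun s hs =>
    (hs.continuous.comp (by fun_prop : Continuous fun θ : ℝ => exp (θ * I))).mul hg
  have key := intervalIntegral.hasDerivAt_integral_of_dominated_loc_of_deriv_le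
    (μ := volume) (a := -Real.pi) (b := Real.pi) (x₀ := (0 : 𝕜))
    (F := fun s θ => φ (s, exp (θ * I)) * g θ)
    (F' := fun s θ => velocity φ ε s (exp (θ * I)) * g θ) (bound := fun θ => C * ‖g θ‖) hball
    (hext.mono fun s hs => (hcont s hs).aestronglyMeasurable)
    ((hcont 0 hext.self_of_nhds).intervalIntegrable _ _)
    (Continuous.aestronglyMeasurable
      (((contDiffOn_velocity hφ h0).continuousOn.comp_continuous
        (by fun_prop : Continuous fun θ : ℝ => exp (θ * I)) exp_mul_I_mem_closedBall).mul hg))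
    (.of_forall fun θ _ s hs => by
      rw [norm_mul]
      exact mul_le_mul_of_nonneg_right ((hC s hs).1 _ (exp_mul_I_mem_closedBall θ))
        (norm_nonneg _))
    ((continuous_const.mul hg.norm).intervalIntegrable _ _)
    (.of_forall fun θ _ s hs =>
      ((hasDerivAt_time_and_fderivWithin hφ (exp_mul_I_mem_closedBall θ)
        (hd _ (exp_mul_I_mem_closedBall θ)) (ball_subset_ball (by linarith) hs)).1).mul_const (g θ))
  -- It is not needed that the velocity itself extends holomorphically: `∮ φ(s, ·) dv` is zero for
  -- all `s` near `0`, hence so is its derivative.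
  refine key.2.unique ((hasDerivAt_const (0 : 𝕜) (0 : ℂ)).congr_of_eventuallyEq ?_)
  exact hext.mono fun s hs => hs.integral_mul_deriv hv hg hvg

/-- The derivatives of the action evaluated on the solutions. -/
theorem hasDerivAt_action {Ω : Set (ℂ × ℂ)} {W Wm1 : ℂ → ℂ → ℂ}
    (hWm1 : ∀ z η : ℂ, ‖z‖ < 1 → (z, η) ∈ Ω → HasDerivAt (Wm1 z) (W z η) η)
    {T : Set (ℕ → 𝕜)} (hT : CoordOpen T) (hTadm : ∀ t ∈ T, Admissible t)
    {u : (ℕ → 𝕜) → ℂ → ℂ} (hsol : ∀ t ∈ T, IsSolution Ω W t (u t)) (hreg : RegularInTimes T u)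
    (hint : ∀ t ∈ T, IntegrableOn (fun z => Wm1 z (dz (fun w => S₀ t w + u t w) z)) (ball 0 1))
    {t : ℕ → 𝕜} (ht : t ∈ T) (n : ℕ) :
    HasDerivAt (fun s : 𝕜 => action Wm1 u (t + Pi.single n s))
      (-((2 * n + 1) * ((2 * Real.pi : ℂ)⁻¹ * moment (u t) (2 * n + 1)))) 0 := by
  obtain ⟨ε, hε, hφ, hd⟩ := hreg t ht n
  set φ : 𝕜 × ℂ → ℂ := fun p => u (t + Pi.single n p.1) p.2 with hφdef
  set p : 𝕜 → ℂ → ℂ := velocity φ ε with hp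
  obtain ⟨C, hC⟩ := exists_bound_slice hε hφ
  obtain ⟨r, hr, hrT⟩ := Metric.eventually_nhds_iff_ball.1 (hT t ht n)
  have ht0 : t + Pi.single n (0 : 𝕜) = t := by simp
  have hball : ball (0 : 𝕜) (ε / 2) ∩ ball 0 r ∈ 𝓝 (0 : 𝕜) :=
    inter_mem (ball_mem_nhds _ (half_pos hε)) (ball_mem_nhds _ hr)
  have h0 : (0 : 𝕜) ∈ ball (0 : 𝕜) ε := mem_ball_self hε
  have hsub : ball (0 : 𝕜) (ε / 2) ⊆ ball 0 ε := ball_subset_ball (by linarith)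
  have hp0 : ContDiffOn ℝ 1 (p 0) (closedBall 0 1) := contDiffOn_velocity hφ h0
  have hu1 := (hsol t ht).contDiffOn_one
  set A : 𝕜 → ℂ → ℂ := fun s z =>
    (1 / 2 * dzbar (u (t + Pi.single n s)) z * dz (u (t + Pi.single n s)) z -
      Wm1 z (dz (fun w => S₀ (t + Pi.single n s) w + u (t + Pi.single n s) w) z)) * (-2 * I) with hA
  -- The derivative of `A` with `W` already eliminated: the term `-S̃_z̄ p_z` coming from `W₋₁`
  -- turns `+½ S̃_z̄ p_z` into `-½ S̃_z̄ p_z`.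
  set A' : 𝕜 → ℂ → ℂ := fun s z =>
    (1 / 2 * (dzbar (p s) z * dz (u (t + Pi.single n s)) z -
        dzbar (u (t + Pi.single n s)) z * dz (p s) z) -
      (2 * n + 1) * (dzbar (u (t + Pi.single n s)) z * z ^ (2 * n))) * (-2 * I) with hA'
  have hAint : ∀ s ∈ ball (0 : 𝕜) r, IntegrableOn (A s) (ball 0 1) := by
    intro s hs
    have hs1 := (hsol _ (hrT s hs)).contDiffOn_one
    have h1 := (integrableOn_dzbar_mul_dz hs1 hs1).const_mul (1 / 2)
    simp only [← mul_assoc] at h1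
    exact (h1.sub (hint _ (hrT s hs))).mul_const _
  have hjac : IntegrableOn (fun z => dzbar (p 0) z * dz (u t) z - dzbar (u t) z * dz (p 0) z)
      (ball 0 1) :=
    (integrableOn_dzbar_mul_dz hp0 hu1).sub (integrableOn_dzbar_mul_dz hu1 hp0)
  have hmom : IntegrableOn (fun z => dzbar (u t) z * z ^ (2 * n)) (ball 0 1) :=
    integrableOn_dzbar_mul hu1 (by fun_prop)
  have hA'0 : A' 0 = fun z => (1 / 2 * (dzbar (p 0) z * dz (u t) z - dzbar (u t) z * dz (p 0) z) -
      (2 * n + 1) * (dzbar (u t) z * z ^ (2 * n))) * (-2 * I) := by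
    simp only [hA', ht0]
  have hA'int : IntegrableOn (A' 0) (ball 0 1) := by
    rw [hA'0]
    exact ((hjac.const_mul _).sub (hmom.const_mul _)).mul_const _
  have hderiv : ∀ z ∈ ball (0 : ℂ) 1, ∀ s ∈ ball (0 : 𝕜) (ε / 2) ∩ ball 0 r,
      HasDerivAt (fun s => A s z) (A' s z) s := by
    intro z hz s hs
    have hz1 : ‖z‖ < 1 := mem_ball_zero_iff.1 hz
    have hsT := hrT s hs.2
    have h1 : HasDerivAt (fun s : 𝕜 => dzbar (u (t + Pi.single n s)) z) (dzbar (p s) z) s :=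
      hasDerivAt_dzbar_slice hφ hd (hsub hs.1) hz
    have h2 : HasDerivAt (fun s : 𝕜 => dz (u (t + Pi.single n s)) z) (dz (p s) z) s :=
      hasDerivAt_dz_slice hφ hd (hsub hs.1) hz
    have h3 : HasDerivAt (fun s : 𝕜 =>
        dz (fun w => S₀ (t + Pi.single n s) w + u (t + Pi.single n s) w) z)
        ((2 * n + 1) * z ^ (2 * n) + dz (p s) z) s := by
      have h4 : HasDerivAt (fun s : 𝕜 => deriv (S₀ t) z + s • ((2 * n + 1) * z ^ (2 * n)) +
          dz (u (t + Pi.single n s)) z) ((2 * n + 1) * z ^ (2 * n) + dz (p s) z) s := by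
        have h5 := ((hasDerivAt_id s).smul_const ((2 * n + 1) * z ^ (2 * n))).const_add
          (deriv (S₀ t) z)
        rw [one_smul] at h5
        exact h5.add h2
      refine h4.congr_of_eventuallyEq ?_
      filter_upwards [isOpen_ball.mem_nhds hs.2] with s' hs'
      rw [(hsol _ (hrT s' hs')).dz_S₀_add (hTadm _ (hrT s' hs')) hz,
        (hTadm t ht).dz_S₀_add_single n s' hz1]
    have h6 := HasDerivAt.comp s
      (hWm1 z _ hz1 ((hsol _ hsT).mem_domain z hz1)) h3
    -- Here the Beltrami equation enters, replacing `W` by `S̃_z̄`.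
    rw [← (hsol _ hsT).beltrami z hz1, (hsol _ hsT).dzbar_S₀_add (hTadm _ hsT) hz] at h6
    refine ((((h1.const_mul (1 / 2 : ℂ)).mul h2).sub h6).mul_const (-2 * I)).congr_deriv ?_
    simp only [hA']
    ring
  -- All four Wirtinger derivatives are at most `C`, `|z| < 1`, and the last factor `2` is `|-2i|`.
  -- No bound on `W` is required, since `A'` does not contain it.
  have hbound : ∀ z ∈ ball (0 : ℂ) 1, ∀ s ∈ ball (0 : 𝕜) (ε / 2) ∩ ball 0 r,
      ‖A' s z‖ ≤ (1 / 2 * (C * C + C * C) + (2 * n + 1) * C) * 2 := by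
    intro z hz s hs
    have hb := (hC s hs.1).2 z hz
    have hu : ‖dz (u (t + Pi.single n s)) z‖ ≤ C := norm_dz_le fun v hv => (hb v hv).1
    have hu' : ‖dzbar (u (t + Pi.single n s)) z‖ ≤ C := norm_dzbar_le fun v hv => (hb v hv).1
    have hq : ‖dz (p s) z‖ ≤ C := norm_dz_le fun v hv => (hb v hv).2
    have hq' : ‖dzbar (p s) z‖ ≤ C := norm_dzbar_le fun v hv => (hb v hv).2
    have hC0 : 0 ≤ C := (norm_nonneg _).trans hu
    have hz1 : ‖z ^ (2 * n)‖ ≤ 1 := by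
      rw [norm_pow]
      exact pow_le_one₀ (norm_nonneg _) (mem_ball_zero_iff.1 hz).le
    have hn : ‖(2 * n + 1 : ℂ)‖ = 2 * n + 1 := by
      have : (2 * n + 1 : ℂ) = ((2 * n + 1 : ℕ) : ℂ) := by push_cast; rfl
      rw [this, Complex.norm_natCast]
      push_cast
      rfl
    have h2I : ‖(-2 * I : ℂ)‖ = 2 := by simp
    simp only [hA']
    rw [norm_mul, h2I]
    refine mul_le_mul_of_nonneg_right ((norm_sub_le _ _).trans (add_le_add ?_ ?_)) zero_le_two
    · rw [norm_mul, show ‖(1 / 2 : ℂ)‖ = 1 / 2 by simp]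
      refine mul_le_mul_of_nonneg_left ((norm_sub_le _ _).trans (add_le_add ?_ ?_)) (by norm_num)
      · rw [norm_mul]
        exact mul_le_mul hq' hu (norm_nonneg _) hC0
      · rw [norm_mul]
        exact mul_le_mul hu' hq (norm_nonneg _) hC0
    · rw [norm_mul, hn, norm_mul]
      refine mul_le_mul_of_nonneg_left ?_ (by positivity)
      simpa using mul_le_mul hu' hz1 (norm_nonneg _) hC0
  have hmain := (hasDerivAt_integral_of_dominated_loc_of_deriv_le (F := A) (F' := A')
    (μ := volume.restrict (ball 0 1))
    (bound := fun _ => (1 / 2 * (C * C + C * C) + (2 * n + 1) * C) * 2) hball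
    (by
      filter_upwards [ball_mem_nhds (0 : 𝕜) hr] with s hs using (hAint s hs).aestronglyMeasurable)
    (hAint 0 (mem_ball_self hr)) hA'int.aestronglyMeasurable
    ((ae_restrict_iff' measurableSet_ball).2 (.of_forall hbound))
    (integrableOn_const measure_ball_lt_top.ne)
    ((ae_restrict_iff' measurableSet_ball).2 (.of_forall hderiv))).2
  have hjac0 : ∫ z in ball (0 : ℂ) 1, (dzbar (p 0) z * dz (u t) z - dzbar (u t) z * dz (p 0) z)
      = 0 := by
    rw [integral_ball_jacobian hp0 (hsol t ht).regular, integral_velocity_mul_deriv hε hφ hd ?_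
      (hsol t ht).isExteriorHolomorphic (continuous_fderivWithin_circle hu1)
      (hasDerivAt_circle (hu1.differentiableOn one_ne_zero)), mul_zero]
    filter_upwards [ball_mem_nhds (0 : 𝕜) hr] with s hs
    exact (hsol _ (hrT s hs)).isExteriorHolomorphic
  -- The holomorphic factor `z^{2n}` moves under `∂/∂z̄`; Cauchy–Green contributes one more
  -- `e^{iθ}`, whence the index `2n+1`.
  have hmom0 : ∫ z in ball (0 : ℂ) 1, dzbar (u t) z * z ^ (2 * n) =
      1 / 2 * moment (u t) (2 * n + 1) := by
    have h1 : ∀ z ∈ ball (0 : ℂ) 1, dzbar (u t) z * z ^ (2 * n) =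
        dzbar (fun w => u t w * w ^ (2 * n)) z := fun z hz =>
      (dzbar_mul_of_differentiableAt ((hsol t ht).differentiableAt hz)
        (differentiableAt_pow (2 * n))).symm
    rw [setIntegral_congr_fun measurableSet_ball h1,
      integral_ball_dzbar (hu1.mul (by fun_prop)), moment]
    congr 1
    refine intervalIntegral.integral_congr fun θ _ => ?_
    ring
  refine (hmain.const_mul (-(1 / (2 * Real.pi * I)))).congr_deriv ?_
  rw [hA'0, integral_mul_const, integral_sub (hjac.const_mul _) (hmom.const_mul _),
    integral_const_mul, integral_const_mul, hjac0, hmom0]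
  have hpi : (Real.pi : ℂ) ≠ 0 := by exact_mod_cast Real.pi_ne_zero
  field_simp
  ring

end Variation

end DBKP

end

theorem mainTheorem1 {𝕜 : Type*} [RCLike 𝕜] [NormedAlgebra 𝕜 ℂ] [IsScalarTower ℝ 𝕜 ℂ]
    (Ω : Set (ℂ × ℂ)) (W Wm1 : ℂ → ℂ → ℂ)
    (hΩ : ∀ z η : ℂ, ‖z‖ < 1 → (z, η) ∈ Ω → (-z, η) ∈ Ω)
    (hW : ∀ z η : ℂ, ‖z‖ < 1 → (z, η) ∈ Ω → W (-z) η = W z η)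
    (hWm1 : ∀ z η : ℂ, ‖z‖ < 1 → (z, η) ∈ Ω → HasDerivAt (Wm1 z) (W z η) η)
    (T : Set (ℕ → 𝕜)) (hT : DBKP.CoordOpen T) (hTadm : ∀ t ∈ T, DBKP.Admissible t)
    (u : (ℕ → 𝕜) → ℂ → ℂ)
    (hsol : ∀ t ∈ T, DBKP.IsSolution Ω W t (u t))
    (huniq : ∀ t ∈ T, ∀ v : ℂ → ℂ, DBKP.IsSolution Ω W t v → v = u t)
    (hreg : DBKP.RegularInTimes T u)
    (hint : ∀ t ∈ T, MeasureTheory.IntegrableOn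
      (fun z => Wm1 z (DBKP.dz (fun w => DBKP.S₀ t w + u t w) z)) (Metric.ball 0 1)) :
    DBKP.IsTauFunction T u (fun t => DBKP.action Wm1 u t / 2) := by
  intro t ht
  -- The reflected function `-S̃(-z)` solves the same problem, so uniqueness identifies it with
  -- `S̃`.
  have hodd : ∀ z, u t (-z) = -u t z := fun z => by
    have h := congrFun (huniq t ht _ ((hsol t ht).neg_comp_neg hΩ hW)) z
    rw [← h, neg_neg]
  have hF := fun n : ℕ =>
    (DBKP.hasDerivAt_action hWm1 hT hTadm hsol hreg hint ht n).div_const 2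
  refine ⟨hodd, fun z hz => ⟨fun n => (hF n).differentiableAt, ?_⟩⟩
  -- Termwise comparison: the `2/(2n+1)` of `𝒟(z)` cancels the `½` of `½F` and the `2n+1` of the
  -- derivative, leaving minus the Laurent term.
  refine ((hsol t ht).isExteriorHolomorphic.hasSum_of_odd hodd hz).neg.congr_fun fun n => ?_
  rw [DBKP.timeDeriv, (hF n).deriv]
  have hn : (2 * n + 1 : ℂ) ≠ 0 := by exact_mod_cast Nat.succ_ne_zero (2 * n)
  field_simp
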